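/- Let $\Omega\subset\mathbb R^2$ be a bounded connected open set with Lipschitz boundary, let $z_1<z_2$, $I=[z_1,z_2]$, and $Q=\Omega\times(z_1,z_2)$. Let $c,\sigma:\Omega\to(0,\infty)$ be measurable and bounded with bounded inverse, and let $h\in L^\infty(\Omega)$; put $\omega_\pm=\{x\in\Omega:\pm h(x)>0\}$. Let $\partial\Omega$ be partitioned into measurable parts $\Gamma_N,\Gamma_D,\Gamma_R,\Gamma_\sharp$ (each possibly empty), where $\Gamma_\sharp=\bigcup_{j=1}^n\bigl(S_j\cup(S_j+p_j)\bigr)$ for finitely many measurable sets $S_j$ and vectors $p_j\in\mathbb R^2$, and let $a\in L^\infty(\Gamma_R)$ with $a>0$ a.e. Let $\Omega\times\{z_1,z_2\}$ be partitioned into measurable sets $\Omega_D$ and $\Omega_N$. Assume that the inlet/outlet condition is Dirichlet where the flow enters, i.e. (up to null sets) \[\omega_+\times\{z_1\}\subset\Omega_D,\qquad \omega_-\times\{z_2\}\subset\Omega_D,\] and that $\Omega_D\cup\bigl((\Gamma_D\cup\Gamma_R)\times I\bigr)$ has positive surface measure (this is automatic unless $h=0$ a.e.). For a function $T_D$ on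 $\Omega_D$ let $\mathcal X(T_D)$ be the set of all $T\in H^1(Q)$ whose trace satisfies $T=0$ on $\Gamma_D\times I$, $T(x+p_j,z)=T(x,z)$ for $x\in S_j$, $z\in I$, $1\le j\le n$, and $T=T_D$ on $\Omega_D$. Let $S_N\in L^2(\Omega_N)$, and let $T_D$ be regular enough in the sense that $\mathcal X(T_D)\neq\emptyset$. Then the Graetz problem \[c\,\partial_{zz}T+\operatorname{div}(\sigma\nabla T)-h\,\partial_zT=0\ \text{ in }Q,\] with the lateral conditions $\sigma\nabla T\cdot n=0$ on $\Gamma_N\times I$, $T=0$ on $\Gamma_D\times I$, $\sigma\nabla T\cdot n+aT=0$ on $\Gamma_R\times I$, $T$ periodic on $\Gamma_\sharp\times I$ (here $\nabla$ and $\operatorname{div}$ act on the variables of $\Omega$), and the inlet/outlet conditions $T=T_D$ on $\Omega_D$, $\partial_zT=S_N$ on $\Omega_N$, has a unique weak solution, that is, there is a unique $T\in\mathcal X(T_D)$ such that for every $\varphi\in\mathcal X(0)$ \[\int_Q\bigl(c\,\partial_zT\,\partial_z\varphi+\sigma\nabla T\cdot\nabla\varphi+h\,\partial_zT\,\varphi\bigr)+\int_{\Gamma_R\times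 I}a\,T\varphi=\int_{\Omega_N\cap(\Omega\times\{z_2\})}c\,S_N\varphi-\int_{\Omega_N\cap(\Omega\times\{z_1\})}c\,S_N\varphi .\] -/

import Mathlib

open MeasureTheory Filter Topology Set
open scoped ENNReal NNReal ContDiff

namespace Graetz

/-- The plane of the cross section, with its Euclidean norm. -/
abbrev Plane : Type := EuclideanSpace ℝ (Fin 2)

/-- Points `(x, z)`: `x` in the cross-sectional plane, `z` along the axis of the cylinder.
The volume is the product (Lebesgue) measure. -/
abbrev Space : Type := Plane × ℝ

/-- Bounded connected open sets which, near each boundary point and in suitable orthonormal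
coordinates, are the strict epigraph of a Lipschitz function. -/
structure IsLipschitzDomain (Ω : Set Plane) : Prop where
  isOpen : IsOpen Ω
  isConnected : IsConnected Ω
  isBounded : Bornology.IsBounded Ω
  lipschitz_boundary : ∀ x ∈ frontier Ω,
    ∃ (L : Plane ≃ₗᵢ[ℝ] Plane) (γ : ℝ → ℝ) (K : ℝ≥0), LipschitzWith K γ ∧
      ∀ᶠ y in 𝓝 x, (y ∈ Ω ↔ γ (L y 0) < L y 1)

/-- The open cylinder `Ω × (z₁, z₂)`. -/
def cylinder (Ω : Set Plane) (z₁ z₂ : ℝ) : Set Space := Ω ×ˢ Ioo z₁ z₂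

/-- The surface measure of the boundary of the cylinder: length of `∂Ω` times `dz` on the lateral
part, and the area on each of the two end sections `Ω × {z₁}` and `Ω × {z₂}`. -/
noncomputable def boundaryMeasure (Ω : Set Plane) (z₁ z₂ : ℝ) : Measure Space :=
  ((Measure.hausdorffMeasure 1).restrict (frontier Ω)).prod (volume.restrict (Ioo z₁ z₂))
    + (volume.restrict Ω).prod (Measure.dirac z₁)
    + (volume.restrict Ω).prod (Measure.dirac z₂)

/-- `v` is the weak derivative of `u` in the direction `e` on the open set `U`. -/
def IsWeakDeriv (U : Set Space) (u v : Space → ℝ) (e : Space) : Prop :=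
  ∀ φ : Space → ℝ, ContDiff ℝ ∞ φ → HasCompactSupport φ → tsupport φ ⊆ U →
    ∫ y in U, u y * fderiv ℝ φ y e = -∫ y in U, v y * φ y

/-- An element of `H¹(Ω × (z₁, z₂))`: a square integrable function together with (representatives
of) its square integrable weak cross-sectional gradient and weak `z`-derivative. -/
structure H1 (Ω : Set Plane) (z₁ z₂ : ℝ) where
  /-- the function -/
  val : Space → ℝ
  /-- the weak gradient in the cross-sectional variables -/
  grad : Space → Plane
  /-- the weak derivative along the axis -/
  dz : Space → ℝ
  memLp_val : MemLp val 2 (volume.restrict (cylinder Ω z₁ z₂))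
  memLp_grad : MemLp grad 2 (volume.restrict (cylinder Ω z₁ z₂))
  memLp_dz : MemLp dz 2 (volume.restrict (cylinder Ω z₁ z₂))
  weak_grad : ∀ e : Plane,
    IsWeakDeriv (cylinder Ω z₁ z₂) val (fun y => inner ℝ (grad y) e) (e, 0)
  weak_dz : IsWeakDeriv (cylinder Ω z₁ z₂) val dz (0, 1)

/-- `g` is the trace of `u ∈ H¹` on the boundary of the cylinder: there are functions smooth up to
the boundary that converge to `u` in `H¹` and whose boundary values converge to `g` in `L²` of
the boundary. -/
structure HasTrace {Ω : Set Plane} {z₁ z₂ : ℝ} (u : H1 Ω z₁ z₂) (g : Space → ℝ) : Prop where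
  memLp : MemLp g 2 (boundaryMeasure Ω z₁ z₂)
  approx : ∃ ψ : ℕ → Space → ℝ, (∀ n, ContDiff ℝ ∞ (ψ n)) ∧
    Tendsto (fun n => eLpNorm (fun y => ψ n y - u.val y) 2
      (volume.restrict (cylinder Ω z₁ z₂))) atTop (𝓝 0) ∧
    Tendsto (fun n => eLpNorm (fun y => gradient (fun x => ψ n (x, y.2)) y.1 - u.grad y) 2
      (volume.restrict (cylinder Ω z₁ z₂))) atTop (𝓝 0) ∧
    Tendsto (fun n => eLpNorm (fun y => deriv (fun z => ψ n (y.1, z)) y.2 - u.dz y) 2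
      (volume.restrict (cylinder Ω z₁ z₂))) atTop (𝓝 0) ∧
    Tendsto (fun n => eLpNorm (fun y => ψ n y - g y) 2 (boundaryMeasure Ω z₁ z₂)) atTop (𝓝 0)

/-- A partition of `∂Ω` into a Neumann part `ΓN`, a Dirichlet part `ΓD`, a Robin part `ΓR` and a
periodic part. The periodic part consists of finitely many pieces `side j` and their translates
`side j + shift j`; the condition there is `T (x + shift j, z) = T (x, z)` for `x ∈ side j`.
Each of the four parts may be empty. -/
structure LateralPartition (Ω : Set Plane) where
  ΓN : Set Plane
  ΓD : Set Plane
  ΓR : Set Plane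
  /-- the number of pairs of identified pieces -/
  numPairs : ℕ
  side : Fin numPairs → Set Plane
  shift : Fin numPairs → Plane
  /-- the periodic part -/
  Γper : Set Plane
  Γper_eq : Γper = ⋃ j, (side j ∪ (fun x => x + shift j) '' side j)
  measurableSet_ΓN : MeasurableSet ΓN
  measurableSet_ΓD : MeasurableSet ΓD
  measurableSet_ΓR : MeasurableSet ΓR
  measurableSet_side : ∀ j, MeasurableSet (side j)
  disjoint_ND : Disjoint ΓN ΓD
  disjoint_NR : Disjoint ΓN ΓR
  disjoint_NP : Disjoint ΓN Γper
  disjoint_DR : Disjoint ΓD ΓR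
  disjoint_DP : Disjoint ΓD Γper
  disjoint_RP : Disjoint ΓR Γper
  cover : ΓN ∪ ΓD ∪ ΓR ∪ Γper = frontier Ω

/-- The essential lateral conditions on a trace `g`: it vanishes on `ΓD × (z₁, z₂)` and is periodic
on the periodic part. -/
def LateralEssential {Ω : Set Plane} (Γ : LateralPartition Ω) (z₁ z₂ : ℝ) (g : Space → ℝ) : Prop :=
  (∀ᵐ y ∂(boundaryMeasure Ω z₁ z₂).restrict (Γ.ΓD ×ˢ Ioo z₁ z₂), g y = 0) ∧
  ∀ j, ∀ᵐ y ∂(boundaryMeasure Ω z₁ z₂).restrict (Γ.side j ×ˢ Ioo z₁ z₂),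
    g (y.1 + Γ.shift j, y.2) = g y

/-- `T` belongs to `H¹`, with trace `g` satisfying the essential lateral conditions and equal to
`TD` on the inlet/outlet part `ΩD`. For `TD = 0` this is the space of test functions. -/
def InAffineSpace {Ω : Set Plane} {z₁ z₂ : ℝ} (Γ : LateralPartition Ω) (ΩD : Set Space)
    (TD : Space → ℝ) (T : H1 Ω z₁ z₂) (g : Space → ℝ) : Prop :=
  HasTrace T g ∧ LateralEssential Γ z₁ z₂ g ∧
    ∀ᵐ y ∂(boundaryMeasure Ω z₁ z₂).restrict ΩD, g y = TD y

/-- The regularity of the Dirichlet datum on `ΩD`: it lies in the trace space, that is, it is the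
restriction to `ΩD` of the trace of some `H¹` function which satisfies the essential lateral
conditions. -/
def IsDirichletDatum {Ω : Set Plane} (Γ : LateralPartition Ω) (z₁ z₂ : ℝ) (ΩD : Set Space)
    (TD : Space → ℝ) : Prop :=
  ∃ (G : H1 Ω z₁ z₂) (g : Space → ℝ), InAffineSpace Γ ΩD TD G g

/-- The variational form of the Graetz operator with the Robin term; `g`, `k` are the traces of
`T`, `φ`. -/
noncomputable def form {Ω : Set Plane} {z₁ z₂ : ℝ} (Γ : LateralPartition Ω)
    (c σ h a : Plane → ℝ) (T : H1 Ω z₁ z₂) (g : Space → ℝ) (φ : H1 Ω z₁ z₂) (k : Space → ℝ) : ℝ :=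
  (∫ y in cylinder Ω z₁ z₂, (c y.1 * T.dz y * φ.dz y + σ y.1 * inner ℝ (T.grad y) (φ.grad y)
      + h y.1 * T.dz y * φ.val y))
    + ∫ y in Γ.ΓR ×ˢ Ioo z₁ z₂, a y.1 * g y * k y ∂(boundaryMeasure Ω z₁ z₂)

/-- `T` is a weak solution of `c ∂_zz T + div (σ ∇T) - h ∂_z T = 0` in `Ω × (z₁, z₂)` with
`σ ∇T · n = 0` on `ΓN`, `T = 0` on `ΓD`, `σ ∇T · n + a T = 0` on `ΓR`, `T` periodic on the periodic
part, `T = TD` on `ΩD` and `∂_z T = SN` on `ΩN`. The outward normal derivative on `ΩN` is `∂_z T`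
at `z₂` and `-∂_z T` at `z₁`. -/
def IsWeakSolution {Ω : Set Plane} {z₁ z₂ : ℝ} (Γ : LateralPartition Ω) (ΩD ΩN : Set Space)
    (c σ h a : Plane → ℝ) (TD SN : Space → ℝ) (T : H1 Ω z₁ z₂) : Prop :=
  ∃ g : Space → ℝ, InAffineSpace Γ ΩD TD T g ∧
    ∀ (φ : H1 Ω z₁ z₂) (k : Space → ℝ), InAffineSpace Γ ΩD 0 φ k →
      form Γ c σ h a T g φ k =
        (∫ y in ΩN ∩ Ω ×ˢ {z₂}, c y.1 * SN y * k y ∂(boundaryMeasure Ω z₁ z₂))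
          - ∫ y in ΩN ∩ Ω ×ˢ {z₁}, c y.1 * SN y * k y ∂(boundaryMeasure Ω z₁ z₂)

/-- Bounded on `Ω`, positive, with bounded inverse (almost everywhere). -/
def IsDiffusionCoefficient (Ω : Set Plane) (f : Plane → ℝ) : Prop :=
  AEStronglyMeasurable f (volume.restrict Ω) ∧
    ∃ m M : ℝ, 0 < m ∧ ∀ᵐ x ∂volume.restrict Ω, m ≤ f x ∧ f x ≤ M

end Graetz

/-!
The statement is Lax–Milgram in the closed subspace of `H¹` data whose traces satisfy the
homogeneous essential conditions. To have traces at hand, a function of `H¹` is recorded as the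
quadruple of its values, its cross-sectional gradient, its axial derivative and its trace; the
admissible quadruples are the closure of those coming from smooth functions.

Coercivity has two ingredients. The first is a Friedrichs inequality. All estimates behind it bound
the double integral of `|f x - f y| ^ 2` between two measures by an energy of `f`. On a Lipschitz
domain one moves along vertical, then horizontal segments of a boundary chart, and joins the
charts through the connected interior; area and boundary length enter on the same footing, so that
the Poincaré and the trace inequality are obtained at once. The product structure carries them over
to the cylinder, where comparing with a weight which is positive on the Dirichlet or Robin part of
the boundary removes the constants. The second is the sign of the convection term: `h` depends on
`x` only, so `∫ h ∂_z T T = ½ ∫ h (T(·, z₂) ^ 2 - T(·, z₁) ^ 2)`, which is nonnegative because `T`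
vanishes at `z₁` where `h > 0` and at `z₂` where `h < 0`.
-/

namespace Graetz

section Oscillation

variable {X A B : Type*} [MeasurableSpace X] [MeasurableSpace A] [MeasurableSpace B]

/-- The mean square oscillation of `f` between the measures `μ` and `ν`. Poincaré, trace and
Friedrichs inequalities are all bounds of oscillations, for various `μ` and `ν`. -/
noncomputable def oscillation (f : X → ℝ) (μ ν : Measure X) : ℝ≥0∞ :=
  ∫⁻ x, ∫⁻ y, ‖f x - f y‖ₑ ^ 2 ∂ν ∂μ

lemma enorm_sub_sq_le {V : Type*} [NormedAddCommGroup V] (a b c : V) :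
    ‖a - c‖ₑ ^ 2 ≤ 2 * (‖a - b‖ₑ ^ 2 + ‖b - c‖ₑ ^ 2) := by
  calc ‖a - c‖ₑ ^ 2 ≤ (‖a - b‖ₑ + ‖b - c‖ₑ) ^ 2 := by
        gcongr
        simpa only [sub_add_sub_cancel] using enorm_add_le (a - b) (b - c)
    _ ≤ _ := by
        have := ENNReal.rpow_add_le_mul_rpow_add_rpow ‖a - b‖ₑ ‖b - c‖ₑ one_le_two
        norm_num at this
        exact this

variable {f : X → ℝ} {μ μ' ν ν' κ : Measure X}

lemma oscillation_mono (f : X → ℝ) (hμ : μ' ≤ μ) (hν : ν' ≤ ν) :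
    oscillation f μ' ν' ≤ oscillation f μ ν :=
  lintegral_mono' hμ fun _ => lintegral_mono' hν le_rfl

lemma oscillation_comm [SFinite μ] [SFinite ν] (hf : Measurable f) :
    oscillation f μ ν = oscillation f ν μ := by
  rw [oscillation, lintegral_lintegral_swap (by fun_prop)]
  simp only [oscillation, enorm_sub_rev]

lemma oscillation_map {g : A → ℝ} {φ : X → A} (hg : Measurable g) (hφ : Measurable φ)
    (μ ν : Measure X) [SFinite ν] :
    oscillation g (μ.map φ) (ν.map φ) = oscillation (g ∘ φ) μ ν := by
  rw [oscillation, lintegral_map (by fun_prop) hφ]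
  exact lintegral_congr fun x => lintegral_map (by fun_prop) hφ

lemma oscillation_trans [IsFiniteMeasure ν] [IsFiniteMeasure κ] (hf : Measurable f) :
    ν univ * oscillation f μ κ
      ≤ 2 * (κ univ * oscillation f μ ν + μ univ * oscillation f ν κ) := by
  have hν : ν univ ≠ ⊤ := measure_ne_top _ _
  calc ν univ * oscillation f μ κ
      = ∫⁻ x, ∫⁻ z, ∫⁻ _, ‖f x - f z‖ₑ ^ 2 ∂ν ∂κ ∂μ := by
        simp only [oscillation, lintegral_const, ← lintegral_const_mul' _ _ hν, mul_comm (ν univ)]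
    _ ≤ ∫⁻ x, ∫⁻ z, 2 * ((∫⁻ y, ‖f x - f y‖ₑ ^ 2 ∂ν) + ∫⁻ y, ‖f z - f y‖ₑ ^ 2 ∂ν) ∂κ ∂μ := by
        refine lintegral_mono fun x => lintegral_mono fun z => ?_
        rw [← lintegral_add_left (by fun_prop), ← lintegral_const_mul _ (by fun_prop)]
        refine lintegral_mono fun y => ?_
        rw [enorm_sub_rev (f z)]
        exact enorm_sub_sq_le _ _ _
    _ = 2 * (κ univ * oscillation f μ ν + μ univ * oscillation f κ ν) := by
        simp_rw [lintegral_const_mul' 2 _ (by simp : (2 : ℝ≥0∞) ≠ ⊤),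
          lintegral_add_left measurable_const, lintegral_const]
        rw [lintegral_add_right _ measurable_const, lintegral_const,
          lintegral_mul_const _ (by fun_prop), mul_comm (κ univ), mul_comm (μ univ)]
        rfl
    _ = _ := by rw [oscillation_comm (μ := κ) hf]

/-- From `(a, b)` to `(a', b')` one passes through `(a, b')`. -/
lemma oscillation_prod_le {f : A × B → ℝ} (hf : Measurable f) (μ ν : Measure A) (κ κ' : Measure B)
    [SFinite μ] [SFinite ν] [SFinite κ] [SFinite κ'] :
    oscillation f (μ.prod κ) (ν.prod κ') ≤
      2 * (ν univ * (∫⁻ a, oscillation (fun b => f (a, b)) κ κ' ∂μ)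
        + κ univ * ∫⁻ b, oscillation (fun a => f (a, b)) μ ν ∂κ') := by
  simp only [oscillation]
  have inner_le : ∀ p, ∫⁻ q, ‖f p - f q‖ₑ ^ 2 ∂(ν.prod κ')
      ≤ 2 * (ν univ * (∫⁻ b', ‖f p - f (p.1, b')‖ₑ ^ 2 ∂κ')
        + ∫⁻ b', ∫⁻ a', ‖f (p.1, b') - f (a', b')‖ₑ ^ 2 ∂ν ∂κ') := by
    intro p
    rw [lintegral_prod_symm _ (by fun_prop), ← lintegral_const_mul _ (by fun_prop),
      ← lintegral_add_left (by fun_prop), ← lintegral_const_mul _ (by fun_prop)]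
    refine lintegral_mono fun b' => ?_
    calc _ ≤ ∫⁻ a', 2 * (‖f p - f (p.1, b')‖ₑ ^ 2 + ‖f (p.1, b') - f (a', b')‖ₑ ^ 2) ∂ν :=
          lintegral_mono fun a' => enorm_sub_sq_le _ _ _
      _ = _ := by
          rw [lintegral_const_mul _ (by fun_prop), lintegral_add_left measurable_const,
            lintegral_const, mul_comm (ν univ)]
  refine (lintegral_mono inner_le).trans_eq ?_
  rw [lintegral_const_mul _ (by fun_prop), lintegral_add_left (by fun_prop),
    lintegral_const_mul _ (by fun_prop), lintegral_prod _ (by fun_prop),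
    lintegral_prod _ (by fun_prop)]
  simp only [lintegral_const]
  rw [lintegral_mul_const _ (by fun_prop), mul_comm (lintegral μ _) (κ univ),
    lintegral_lintegral_swap (μ := μ) (ν := κ') (by fun_prop)]

lemma oscillation_prod_right_le {f : A × B → ℝ} (μ : Measure (A × B))
    (ν : Measure A) (κ : Measure B) [SFinite ν] [SFinite κ] {v : A → ℝ≥0∞} {w : B → ℝ≥0∞}
    (hv : Measurable v) (hw : Measurable w)
    (hfv : ∀ᵐ p ∂μ, ∀ᵐ b ∂κ, ‖f p - f (p.1, b)‖ₑ ^ 2 ≤ v p.1)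
    (hfw : ∀ᵐ p ∂μ, ∀ᵐ q ∂ν.prod κ, ‖f (p.1, q.2) - f q‖ₑ ^ 2 ≤ w q.2) :
    oscillation f μ (ν.prod κ) ≤
      2 * (ν univ * κ univ * ∫⁻ a, v a ∂μ.map Prod.fst + μ univ * (ν univ * ∫⁻ b, w b ∂κ)) := by
  have inner_le : ∀ᵐ p ∂μ, ∫⁻ q, ‖f p - f q‖ₑ ^ 2 ∂ν.prod κ
      ≤ 2 * (ν univ * κ univ * v p.1 + ν univ * ∫⁻ b, w b ∂κ) := by
    filter_upwards [hfv, hfw] with p hpv hpw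
    calc ∫⁻ q, ‖f p - f q‖ₑ ^ 2 ∂ν.prod κ ≤ ∫⁻ q, 2 * (v p.1 + w q.2) ∂ν.prod κ := by
          refine lintegral_mono_ae ?_
          filter_upwards [Measure.quasiMeasurePreserving_snd.ae hpv, hpw] with q hqv hqw
          refine (enorm_sub_sq_le _ (f (p.1, q.2)) _).trans ?_
          gcongr
      _ = 2 * (ν univ * κ univ * v p.1 + ν univ * ∫⁻ b, w b ∂κ) := by
          rw [lintegral_const_mul _ (by fun_prop), lintegral_add_left measurable_const,
            lintegral_const, ← univ_prod_univ, Measure.prod_prod, mul_comm (v p.1),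
            lintegral_prod_symm _ (by fun_prop)]
          simp only [lintegral_const]
          rw [lintegral_mul_const _ hw, mul_comm (lintegral κ w)]
  refine (lintegral_mono_ae inner_le).trans_eq ?_
  rw [lintegral_const_mul _ (by fun_prop), lintegral_add_right _ measurable_const,
    lintegral_const_mul _ (by fun_prop), lintegral_const, lintegral_map hv measurable_fst,
    mul_comm (μ univ)]

/-- The oscillation between `μ` and `ν` of the functions in the class `F` is bounded by their
energy `E`, up to a constant. -/
def OscControlled (F : Set (X → ℝ)) (E : (X → ℝ) → ℝ≥0∞) (μ ν : Measure X) : Prop :=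
  ∃ C : ℝ≥0∞, C ≠ ⊤ ∧ ∀ f ∈ F, oscillation f μ ν ≤ C * E f

namespace OscControlled

variable {F : Set (X → ℝ)} {E : (X → ℝ) → ℝ≥0∞}

lemma mono (h : OscControlled F E μ ν) (hμ : μ' ≤ μ) (hν : ν' ≤ ν) : OscControlled F E μ' ν' := by
  obtain ⟨C, hC, hle⟩ := h
  exact ⟨C, hC, fun f hf => (oscillation_mono f hμ hν).trans (hle f hf)⟩

lemma symm [SFinite μ] [SFinite ν] (hF : ∀ f ∈ F, Measurable f) (h : OscControlled F E μ ν) :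
    OscControlled F E ν μ := by
  obtain ⟨C, hC, hle⟩ := h
  exact ⟨C, hC, fun f hf => (oscillation_comm (hF f hf)).trans_le (hle f hf)⟩

lemma zero_left : OscControlled F E 0 ν := ⟨0, by simp, fun f _ => by simp [oscillation]⟩

lemma add_left (h : OscControlled F E μ ν) (h' : OscControlled F E μ' ν) :
    OscControlled F E (μ + μ') ν := by
  obtain ⟨C, hC, hle⟩ := h
  obtain ⟨C', hC', hle'⟩ := h'
  refine ⟨C + C', by finiteness, fun f hf => ?_⟩
  rw [oscillation, lintegral_add_measure, add_mul]
  exact add_le_add (hle f hf) (hle' f hf)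

lemma smul_left (h : OscControlled F E μ ν) (c : ℝ≥0) : OscControlled F E (c • μ) ν := by
  obtain ⟨C, hC, hle⟩ := h
  refine ⟨c * C, by finiteness, fun f hf => ?_⟩
  rw [oscillation, lintegral_smul_measure, mul_assoc]
  exact mul_le_mul_right (hle f hf) (c : ℝ≥0∞)

lemma trans [IsFiniteMeasure μ] [IsFiniteMeasure ν] [IsFiniteMeasure κ]
    (hF : ∀ f ∈ F, Measurable f) (hν : ν ≠ 0)
    (h : OscControlled F E μ ν) (h' : OscControlled F E ν κ) : OscControlled F E μ κ := by
  obtain ⟨C, hC, hle⟩ := h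
  obtain ⟨C', hC', hle'⟩ := h'
  have hν0 : ν univ ≠ 0 := by simpa using hν
  refine ⟨(ν univ)⁻¹ * (2 * (κ univ * C + μ univ * C')), by finiteness, fun f hf => ?_⟩
  calc oscillation f μ κ = (ν univ)⁻¹ * (ν univ * oscillation f μ κ) := by
        rw [← mul_assoc, ENNReal.inv_mul_cancel hν0 (measure_ne_top _ _), one_mul]
    _ ≤ (ν univ)⁻¹ * (2 * (κ univ * (C * E f) + μ univ * (C' * E f))) := by
        grw [oscillation_trans (hF f hf), hle f hf, hle' f hf]
    _ = _ := by ring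

end OscControlled

end Oscillation

section Line

variable {E F : Type*} [NormedAddCommGroup E] [NormedSpace ℝ E] [NormedAddCommGroup F]
  [NormedSpace ℝ F]

theorem enorm_sub_sq_le_lintegral_deriv [CompleteSpace F] {f : ℝ → F} (hf : ContDiff ℝ 1 f)
    {a b s t : ℝ} (hs : s ∈ Icc a b) (ht : t ∈ Icc a b) :
    ‖f s - f t‖ₑ ^ 2 ≤ ENNReal.ofReal (b - a) * ∫⁻ θ in Ioo a b, ‖deriv f θ‖ₑ ^ 2 := by
  wlog hst : t ≤ s generalizing s t
  · rw [enorm_sub_rev]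
    exact this ht hs (le_of_not_ge hst)
  have deriv_cont : Continuous (deriv f) := hf.continuous_deriv le_rfl
  have ftc : f s - f t = ∫ θ in t..s, deriv f θ :=
    (intervalIntegral.integral_deriv_eq_sub
      (fun x _ => hf.differentiable one_ne_zero x) (deriv_cont.intervalIntegrable _ _)).symm
  have le_L1 : ‖f s - f t‖ₑ ≤ ∫⁻ θ in Ioo a b, ‖deriv f θ‖ₑ := by
    rw [ftc, intervalIntegral.integral_of_le hst, restrict_Ioo_eq_restrict_Ioc]
    exact (enorm_integral_le_lintegral_enorm _).trans
      (lintegral_mono_set (Ioc_subset_Ioc ht.1 hs.2))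
  have cauchy_schwarz := ENNReal.lintegral_mul_le_Lp_mul_Lq (volume.restrict (Ioo a b))
    Real.HolderConjugate.two_two (f := fun _ => 1) (g := fun θ => ‖deriv f θ‖ₑ)
    aemeasurable_const (by fun_prop)
  simp only [Pi.mul_apply, one_mul, ENNReal.one_rpow, lintegral_const, Measure.restrict_apply_univ,
    Real.volume_Ioo] at cauchy_schwarz
  calc ‖f s - f t‖ₑ ^ 2 ≤ _ := pow_le_pow_left' (le_L1.trans cauchy_schwarz) 2
    _ = _ := by
      rw [mul_pow, ← ENNReal.rpow_natCast, ← ENNReal.rpow_natCast, ← ENNReal.rpow_mul,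
        ← ENNReal.rpow_mul]
      norm_num

lemma enorm_deriv_comp_line_le {f : E → F} (hf : Differentiable ℝ f) {e : E} (he : ‖e‖ ≤ 1)
    (x : E) (t : ℝ) : ‖deriv (fun θ : ℝ => f (x + θ • e)) t‖ₑ ≤ ‖fderiv ℝ f (x + t • e)‖ₑ := by
  have line : HasDerivAt (fun θ : ℝ => x + θ • e) e t := by
    simpa using ((hasDerivAt_id t).smul_const e).const_add x
  have chain : deriv (fun θ : ℝ => f (x + θ • e)) t = fderiv ℝ f (x + t • e) e :=
    ((hf _).hasFDerivAt.comp_hasDerivAt t line).deriv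
  rw [chain, enorm_le_iff_norm_le]
  exact (fderiv ℝ f (x + t • e)).le_of_opNorm_le_of_le le_rfl he |>.trans_eq (mul_one _)

theorem enorm_sub_sq_le_lintegral_indicator_fderiv [CompleteSpace F] {f : E → F}
    (hf : ContDiff ℝ 1 f) {U : Set E} {x e : E} (he : ‖e‖ ≤ 1) {a b s t : ℝ} (hs : s ∈ Icc a b)
    (ht : t ∈ Icc a b) (hU : ∀ θ ∈ Ioo a b, x + θ • e ∈ U) :
    ‖f (x + s • e) - f (x + t • e)‖ₑ ^ 2 ≤ ENNReal.ofReal (b - a) *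
      ∫⁻ θ : ℝ, U.indicator (fun y => ‖fderiv ℝ f y‖ₑ ^ 2) (x + θ • e) := by
  calc ‖f (x + s • e) - f (x + t • e)‖ₑ ^ 2
      ≤ ENNReal.ofReal (b - a) * ∫⁻ θ in Ioo a b, ‖deriv (fun θ : ℝ => f (x + θ • e)) θ‖ₑ ^ 2 :=
        enorm_sub_sq_le_lintegral_deriv (f := fun θ : ℝ => f (x + θ • e)) (by fun_prop) hs ht
    _ ≤ _ := by
        rw [← lintegral_indicator measurableSet_Ioo]
        refine mul_le_mul_right (lintegral_mono fun θ => ?_) _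
        by_cases hθ : θ ∈ Ioo a b
        · rw [indicator_of_mem hθ, indicator_of_mem (hU θ hθ)]
          exact pow_le_pow_left' (enorm_deriv_comp_line_le (hf.differentiable one_ne_zero) he x θ) 2
        · simp only [indicator_of_notMem hθ, zero_le]

end Line

section Chart

variable (L : Plane ≃ₗᵢ[ℝ] Plane)

/-- The parametrization of the plane by the coordinates `(L y 0, L y 1)` of a point `y` in an
orthonormal frame `L`. -/
noncomputable def chart : (ℝ × ℝ) ≃L[ℝ] Plane :=
  ((ContinuousLinearEquiv.finTwoArrow ℝ ℝ).symm.trans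
    (PiLp.continuousLinearEquiv 2 ℝ fun _ => ℝ).symm).trans L.symm.toContinuousLinearEquiv

lemma apply_chart_zero (p : ℝ × ℝ) : L (chart L p) 0 = p.1 :=
  congrArg Prod.fst ((chart L).symm_apply_apply p)

lemma apply_chart_one (p : ℝ × ℝ) : L (chart L p) 1 = p.2 :=
  congrArg Prod.snd ((chart L).symm_apply_apply p)

lemma chart_eq_add_smul (s t : ℝ) : chart L (s, t) = chart L (s, 0) + t • chart L (0, 1) := by
  rw [← map_smul, ← map_add]
  simp

lemma chart_eq_add_smul' (s t : ℝ) : chart L (s, t) = chart L (0, t) + s • chart L (1, 0) := by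
  rw [← map_smul, ← map_add]
  simp

lemma norm_chart (p : ℝ × ℝ) : ‖chart L p‖ = √(p.1 ^ 2 + p.2 ^ 2) := by
  rw [← L.norm_map, EuclideanSpace.norm_eq, Fin.sum_univ_two, apply_chart_zero, apply_chart_one]
  simp

lemma norm_chart_le (p : ℝ × ℝ) : ‖chart L p‖ ≤ |p.1| + |p.2| := by
  rw [norm_chart, ← sq_abs p.1, ← sq_abs p.2]
  exact Real.sqrt_le_iff.2 ⟨by positivity, by nlinarith [abs_nonneg p.1, abs_nonneg p.2]⟩

lemma measurePreserving_chart : MeasurePreserving (chart L) volume volume :=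
  L.symm.measurePreserving.comp
    ((PiLp.volume_preserving_toLp (Fin 2)).comp (volume_preserving_finTwoArrow ℝ).symm)

lemma map_chart_restrict (A : Set (ℝ × ℝ)) :
    (volume.restrict A).map (chart L) = volume.restrict (chart L '' A) :=
  ((measurePreserving_chart L).restrict_image_emb
    (chart L).toHomeomorph.measurableEmbedding A).map_eq

lemma lipschitzWith_chart_graph {γ : ℝ → ℝ} {K : ℝ≥0} (hγ : LipschitzWith K γ) :
    LipschitzWith (1 + K) fun s => chart L (s, γ s) := by
  refine LipschitzWith.of_dist_le_mul fun s s' => ?_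
  have := hγ.dist_le_mul s s'
  calc dist (chart L (s, γ s)) (chart L (s', γ s')) ≤ |s - s'| + |γ s - γ s'| := by
        rw [dist_eq_norm, ← map_sub]
        exact norm_chart_le L ((s, γ s) - (s', γ s'))
    _ ≤ _ := by
        simp only [Real.dist_eq] at this ⊢
        push_cast
        linarith

end Chart

section DirichletControlled

variable {Ω : Set Plane}

/-- The Dirichlet energy of `f` on `Ω`. -/
noncomputable def dirichletEnergy (Ω : Set Plane) (f : Plane → ℝ) : ℝ≥0∞ :=
  ∫⁻ x in Ω, ‖fderiv ℝ f x‖ₑ ^ 2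

/-- The oscillation of continuously differentiable functions between `μ` and `ν` is bounded by
their Dirichlet energy on `Ω`, up to a constant. -/
abbrev DirichletControlled (Ω : Set Plane) (μ ν : Measure Plane) : Prop :=
  OscControlled {f | ContDiff ℝ 1 f} (dirichletEnergy Ω) μ ν

/-- The density of the Dirichlet energy, extended by `0` outside `Ω`. -/
noncomputable def energyDensity (Ω : Set Plane) (f : Plane → ℝ) : Plane → ℝ≥0∞ :=
  Ω.indicator fun x => ‖fderiv ℝ f x‖ₑ ^ 2

variable (L : Plane ≃ₗᵢ[ℝ] Plane) {f : Plane → ℝ}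

lemma measurable_energyDensity_chart (hΩ : MeasurableSet Ω) (hf : ContDiff ℝ 1 f) :
    Measurable fun p => energyDensity Ω f (chart L p) :=
  (((hf.continuous_fderiv one_ne_zero).measurable.enorm.pow_const 2).indicator hΩ).comp
    (chart L).continuous.measurable

lemma lintegral_energyDensity_chart (hΩ : MeasurableSet Ω) :
    ∫⁻ p, energyDensity Ω f (chart L p) = dirichletEnergy Ω f := by
  rw [(measurePreserving_chart L).lintegral_comp_emb
    (chart L).toHomeomorph.measurableEmbedding, energyDensity, lintegral_indicator hΩ,
    dirichletEnergy]

variable {L} in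
lemma enorm_sub_sq_le_lintegral_vertical (hf : ContDiff ℝ 1 f) {s a b t t' : ℝ} (ht : t ∈ Icc a b)
    (ht' : t' ∈ Icc a b) (hΩ : ∀ θ ∈ Ioo a b, chart L (s, θ) ∈ Ω) :
    ‖f (chart L (s, t)) - f (chart L (s, t'))‖ₑ ^ 2
      ≤ ENNReal.ofReal (b - a) * ∫⁻ θ, energyDensity Ω f (chart L (s, θ)) := by
  have := enorm_sub_sq_le_lintegral_indicator_fderiv hf (U := Ω) (x := chart L (s, 0))
    (e := chart L (0, 1)) (by simp [norm_chart]) ht ht'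
  simp only [← chart_eq_add_smul] at this
  exact this hΩ

variable {L} in
lemma enorm_sub_sq_le_lintegral_horizontal (hf : ContDiff ℝ 1 f) {t a b s s' : ℝ}
    (hs : s ∈ Icc a b) (hs' : s' ∈ Icc a b) (hΩ : ∀ θ ∈ Ioo a b, chart L (θ, t) ∈ Ω) :
    ‖f (chart L (s, t)) - f (chart L (s', t))‖ₑ ^ 2
      ≤ ENNReal.ofReal (b - a) * ∫⁻ θ, energyDensity Ω f (chart L (θ, t)) := by
  have := enorm_sub_sq_le_lintegral_indicator_fderiv hf (U := Ω) (x := chart L (0, t))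
    (e := chart L (1, 0)) (by simp [norm_chart]) hs hs'
  simp only [← chart_eq_add_smul'] at this
  exact this hΩ

/-- A measure carried by the vertical segments over the graph of `γ` is compared with the rectangle
at the top of these segments by moving first along the segments, then horizontally. -/
theorem dirichletControlled_strip (hΩ : MeasurableSet Ω) {s₁ s₂ t₀ t₁ t₂ : ℝ} {γ : ℝ → ℝ}
    (hγ : ∀ s ∈ Ioo s₁ s₂, γ s ∈ Icc t₀ t₁)
    (hsub : ∀ s ∈ Ioo s₁ s₂, ∀ t ∈ Ioo (γ s) t₂, chart L (s, t) ∈ Ω)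
    (μ : Measure (ℝ × ℝ)) [IsFiniteMeasure μ]
    (hμ : ∀ᵐ p ∂μ, p.1 ∈ Ioo s₁ s₂ ∧ p.2 ∈ Icc (γ p.1) t₂) {C : ℝ≥0∞} (hC : C ≠ ⊤)
    (hfst : μ.map Prod.fst ≤ C • volume.restrict (Ioo s₁ s₂)) :
    DirichletControlled Ω (μ.map (chart L))
      (volume.restrict (chart L '' Ioo s₁ s₂ ×ˢ Ioo t₁ t₂)) := by
  set S := volume.restrict (Ioo s₁ s₂)
  set T := volume.restrict (Ioo t₁ t₂)
  let v (f : Plane → ℝ) s := ENNReal.ofReal (t₂ - t₀) * ∫⁻ t, energyDensity Ω f (chart L (s, t))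
  let w (f : Plane → ℝ) t := ENNReal.ofReal (s₂ - s₁) * ∫⁻ s, energyDensity Ω f (chart L (s, t))
  refine ⟨2 * (S univ * T univ * (C * ENNReal.ofReal (t₂ - t₀))
    + μ univ * (S univ * ENNReal.ofReal (s₂ - s₁))), by finiteness,
    fun f (hf : ContDiff ℝ 1 f) => ?_⟩
  have vertical : ∀ᵐ p ∂μ, ∀ᵐ t ∂T, ‖f (chart L p) - f (chart L (p.1, t))‖ₑ ^ 2 ≤ v f p.1 := by
    filter_upwards [hμ] with ⟨s, t'⟩ ⟨hs, ht'⟩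
    filter_upwards [ae_restrict_mem measurableSet_Ioo] with t ht
    grw [enorm_sub_sq_le_lintegral_vertical hf ht' ⟨(hγ s hs).2.trans ht.1.le, ht.2.le⟩ (hsub s hs),
      ENNReal.ofReal_le_ofReal (sub_le_sub_left (hγ s hs).1 t₂)]
  have horizontal : ∀ᵐ p ∂μ, ∀ᵐ q ∂S.prod T,
      ‖f (chart L (p.1, q.2)) - f (chart L q)‖ₑ ^ 2 ≤ w f q.2 := by
    filter_upwards [hμ] with p hp
    rw [Measure.prod_restrict]
    filter_upwards [ae_restrict_mem (measurableSet_Ioo.prod measurableSet_Ioo)] with q ⟨hs, ht⟩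
    exact enorm_sub_sq_le_lintegral_horizontal hf (Ioo_subset_Icc_self hp.1)
      (Ioo_subset_Icc_self hs) fun θ hθ => hsub θ hθ _ ⟨(hγ θ hθ).2.trans_lt ht.1, ht.2⟩
  have density_meas := measurable_energyDensity_chart L hΩ hf
  have lintegral_v : ∫⁻ s, v f s = ENNReal.ofReal (t₂ - t₀) * dirichletEnergy Ω f := by
    rw [lintegral_const_mul _ density_meas.lintegral_prod_right', ← lintegral_energyDensity_chart L
      hΩ, Measure.volume_eq_prod, lintegral_prod _ density_meas.aemeasurable]
  have lintegral_w : ∫⁻ t, w f t = ENNReal.ofReal (s₂ - s₁) * dirichletEnergy Ω f := by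
    rw [lintegral_const_mul _ density_meas.lintegral_prod_left', ← lintegral_energyDensity_chart L
      hΩ, Measure.volume_eq_prod, lintegral_prod_symm _ density_meas.aemeasurable]
  rw [← map_chart_restrict, oscillation_map hf.continuous.measurable
    (chart L).continuous.measurable, Measure.volume_eq_prod, ← Measure.prod_restrict]
  calc oscillation (f ∘ chart L) μ (S.prod T)
      ≤ 2 * (S univ * T univ * ∫⁻ s, v f s ∂μ.map Prod.fst
        + μ univ * (S univ * ∫⁻ t, w f t ∂T)) :=
        oscillation_prod_right_le μ S T (density_meas.lintegral_prod_right'.const_mul _)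
          (density_meas.lintegral_prod_left'.const_mul _) vertical horizontal
    _ ≤ 2 * (S univ * T univ * (C * ∫⁻ s, v f s) + μ univ * (S univ * ∫⁻ t, w f t)) := by
        gcongr
        · grw [hfst, lintegral_smul_measure, setLIntegral_le_lintegral, smul_eq_mul]
        · exact Measure.restrict_le_self
    _ = _ := by
        rw [lintegral_v, lintegral_w]
        ring

end DirichletControlled

lemma exists_Ioo_prod_Ioo_subset_of_mem_nhds {p : ℝ × ℝ} {A : Set (ℝ × ℝ)} (hA : A ∈ 𝓝 p) :
    ∃ s₁ s₂ t₁ t₂, p ∈ Ioo s₁ s₂ ×ˢ Ioo t₁ t₂ ∧ Ioo s₁ s₂ ×ˢ Ioo t₁ t₂ ⊆ A := by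
  obtain ⟨S, hS, T, hT, hST⟩ := mem_nhds_prod_iff.1 hA
  obtain ⟨s₁, s₂, hs, hsS⟩ := mem_nhds_iff_exists_Ioo_subset.1 hS
  obtain ⟨t₁, t₂, ht, htT⟩ := mem_nhds_iff_exists_Ioo_subset.1 hT
  exact ⟨s₁, s₂, t₁, t₂, ⟨hs, ht⟩, (prod_mono hsS htT).trans hST⟩

lemma map_fst_restrict_le {A B : Type*} [MeasureSpace A] [MeasureSpace B]
    [SFinite (volume : Measure A)] [SFinite (volume : Measure B)] {R : Set (A × B)} {S : Set A}
    {T : Set B} (h : R ⊆ S ×ˢ T) :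
    (volume.restrict R).map Prod.fst ≤ volume T • volume.restrict S := by
  refine (Measure.map_mono (Measure.restrict_mono h le_rfl) measurable_fst).trans_eq ?_
  rw [Measure.volume_eq_prod, ← Measure.prod_restrict, Measure.map_fst_prod,
    Measure.restrict_apply_univ]

lemma isFiniteMeasure_restrict_of_subset_Ioo_prod_Ioo {R : Set (ℝ × ℝ)} {s₁ s₂ t₁ t₂ : ℝ}
    (h : R ⊆ Ioo s₁ s₂ ×ˢ Ioo t₁ t₂) : IsFiniteMeasure (volume.restrict R) :=
  isFiniteMeasure_restrict.2 (((Metric.isBounded_Ioo s₁ s₂).prod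
    (Metric.isBounded_Ioo t₁ t₂)).subset h).measure_lt_top.ne

theorem exists_isOpen_dirichletControlled_self {Ω : Set Plane} (hΩ : IsOpen Ω) {x : Plane}
    (hx : x ∈ Ω) : ∃ U ⊆ Ω, IsOpen U ∧ x ∈ U ∧ volume U ≠ ⊤ ∧
      DirichletControlled Ω (volume.restrict U) (volume.restrict U) := by
  let L := LinearIsometryEquiv.refl ℝ Plane
  obtain ⟨s₁, s₂, t₁, t₂, hmem, hsub⟩ := exists_Ioo_prod_Ioo_subset_of_mem_nhds
    ((hΩ.preimage (chart L).continuous).mem_nhds (x := (chart L).symm x) (by simpa))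
  have := isFiniteMeasure_restrict_of_subset_Ioo_prod_Ioo (Subset.refl (Ioo s₁ s₂ ×ˢ Ioo t₁ t₂))
  refine ⟨chart L '' Ioo s₁ s₂ ×ˢ Ioo t₁ t₂, image_subset_iff.2 hsub,
    (chart L).isOpenMap _ (isOpen_Ioo.prod isOpen_Ioo), ⟨_, hmem, by simp⟩, ?_, ?_⟩
  · rw [← Measure.restrict_apply_univ, ← map_chart_restrict]
    exact measure_ne_top _ _
  · rw [← map_chart_restrict]
    refine (map_chart_restrict L (Ioo s₁ s₂ ×ˢ Ioo t₁ t₂)) ▸ dirichletControlled_strip L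
      hΩ.measurableSet (γ := fun _ => t₁) (t₀ := t₁) (fun _ _ => ⟨le_rfl, le_rfl⟩)
      (fun s hs t ht => hsub ⟨hs, ht⟩) _ ?_ measure_Ioo_lt_top.ne (map_fst_restrict_le Subset.rfl)
    filter_upwards [ae_restrict_mem (measurableSet_Ioo.prod measurableSet_Ioo)] with p hp
    exact ⟨hp.1, Ioo_subset_Icc_self hp.2⟩

section GraphRectangle

lemma frontier_inter_congr {X : Type*} [TopologicalSpace X] {A B W : Set X} (hW : IsOpen W)
    (h : A ∩ W = B ∩ W) : frontier A ∩ W = frontier B ∩ W := by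
  rw [← frontier_inter_open_inter hW, h, frontier_inter_open_inter hW]

lemma graph_eq_of_mem_frontier {A W : Set (ℝ × ℝ)} {γ : ℝ → ℝ} (hγ : Continuous γ) (hW : IsOpen W)
    (h : ∀ p ∈ W, p ∈ A ↔ γ p.1 < p.2) {p : ℝ × ℝ} (hpA : p ∈ frontier A) (hpW : p ∈ W) :
    γ p.1 = p.2 := by
  have congr : frontier A ∩ W = frontier {p | γ p.1 < p.2} ∩ W :=
    frontier_inter_congr hW (Set.ext fun q => and_congr_left (h q))
  exact frontier_lt_subset_eq (by fun_prop) (by fun_prop) (congr.subset ⟨hpA, hpW⟩).1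

/-- Inside the rectangle `(s₁, s₂) × (t₁, t₃)`, the set `A` is the epigraph of `γ`, and the graph
of `γ` lies strictly between the levels `t₁` and `t₂`. -/
structure IsGraphRectangle (A : Set (ℝ × ℝ)) (γ : ℝ → ℝ) (s₁ s₂ t₁ t₂ t₃ : ℝ) : Prop where
  level_lt : t₂ < t₃
  graph_mem : ∀ s ∈ Ioo s₁ s₂, γ s ∈ Ioo t₁ t₂
  mem_iff : ∀ p ∈ Ioo s₁ s₂ ×ˢ Ioo t₁ t₃, p ∈ A ↔ γ p.1 < p.2

lemma exists_isGraphRectangle {A : Set (ℝ × ℝ)} {γ : ℝ → ℝ} (hγ : Continuous γ) {p : ℝ × ℝ}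
    (hp : p ∈ frontier A) (hA : ∀ᶠ q in 𝓝 p, q ∈ A ↔ γ q.1 < q.2) :
    ∃ s₁ s₂ t₁ t₂ t₃, p ∈ Ioo s₁ s₂ ×ˢ Ioo t₁ t₂ ∧ IsGraphRectangle A γ s₁ s₂ t₁ t₂ t₃ := by
  obtain ⟨a₁, a₂, t₁, t₃, ⟨hpa, hpt⟩, hA⟩ := exists_Ioo_prod_Ioo_subset_of_mem_nhds hA
  have on_graph : γ p.1 = p.2 :=
    graph_eq_of_mem_frontier hγ (isOpen_Ioo.prod isOpen_Ioo) hA hp ⟨hpa, hpt⟩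
  obtain ⟨t₂, ht₂⟩ := exists_between hpt.2
  have near : Ioo a₁ a₂ ∩ γ ⁻¹' Ioo t₁ t₂ ∈ 𝓝 p.1 :=
    (isOpen_Ioo.inter (isOpen_Ioo.preimage hγ)).mem_nhds ⟨hpa, by simp [on_graph, hpt.1, ht₂.1]⟩
  obtain ⟨s₁, s₂, hps, hs⟩ := mem_nhds_iff_exists_Ioo_subset.1 near
  exact ⟨s₁, s₂, t₁, t₂, t₃, ⟨hps, hpt.1, ht₂.1⟩, ht₂.2, fun s h => (hs h).2,
    fun q hq => hA ⟨(hs hq.1).1, hq.2⟩⟩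

lemma hausdorffMeasure_restrict_image_le {X Y : Type*} [EMetricSpace X] [MeasurableSpace X]
    [BorelSpace X] [EMetricSpace Y] [MeasurableSpace Y] [BorelSpace Y] {K : ℝ≥0} {G : X → Y}
    (hG : LipschitzWith K G) {d : ℝ} (hd : 0 ≤ d) (S : Set X) :
    (Measure.hausdorffMeasure d).restrict (G '' S)
      ≤ (K : ℝ≥0∞) ^ d • ((Measure.hausdorffMeasure d).restrict S).map G := by
  have hGm := hG.continuous.measurable
  refine Measure.le_iff.2 fun B hB => ?_
  rw [Measure.restrict_apply hB, Measure.smul_apply, Measure.map_apply hGm hB,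
    Measure.restrict_apply (hGm hB), inter_comm, ← image_inter_preimage, inter_comm S]
  exact hG.lipschitzOnWith.hausdorffMeasure_image_le hd

/-- The area measure on `Ω` together with the length measure on its boundary, used to treat
interior and boundary values at once. -/
noncomputable def closureMeasure (Ω : Set Plane) : Measure Plane :=
  volume.restrict Ω + (Measure.hausdorffMeasure 1).restrict (frontier Ω)

variable {Ω : Set Plane} {L : Plane ≃ₗᵢ[ℝ] Plane} {γ : ℝ → ℝ} {s₁ s₂ t₁ t₂ t₃ : ℝ}

namespace IsGraphRectangle

lemma image_upper_subset (h : IsGraphRectangle (chart L ⁻¹' Ω) γ s₁ s₂ t₁ t₂ t₃) :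
    chart L '' Ioo s₁ s₂ ×ˢ Ioo t₂ t₃ ⊆ Ω := by
  rintro _ ⟨p, ⟨hs, ht⟩, rfl⟩
  have hγ := h.graph_mem _ hs
  exact (h.mem_iff p ⟨hs, (hγ.1.trans hγ.2).trans ht.1, ht.2⟩).2 (hγ.2.trans ht.1)

lemma dirichletControlled_map (h : IsGraphRectangle (chart L ⁻¹' Ω) γ s₁ s₂ t₁ t₂ t₃)
    (hΩ : MeasurableSet Ω) (μ : Measure (ℝ × ℝ)) [IsFiniteMeasure μ]
    (hμ : ∀ᵐ p ∂μ, p.1 ∈ Ioo s₁ s₂ ∧ p.2 ∈ Icc (γ p.1) t₃) {C : ℝ≥0∞} (hC : C ≠ ⊤)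
    (hfst : μ.map Prod.fst ≤ C • volume.restrict (Ioo s₁ s₂)) :
    DirichletControlled Ω (μ.map (chart L))
      (volume.restrict (chart L '' Ioo s₁ s₂ ×ˢ Ioo t₂ t₃)) :=
  dirichletControlled_strip L hΩ (fun s hs => Ioo_subset_Icc_self (h.graph_mem s hs))
    (fun s hs t ht => (h.mem_iff (s, t) ⟨hs, (h.graph_mem s hs).1.trans ht.1, ht.2⟩).2 ht.1)
    μ hμ hC hfst

lemma dirichletControlled_volume (h : IsGraphRectangle (chart L ⁻¹' Ω) γ s₁ s₂ t₁ t₂ t₃)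
    (hΩ : MeasurableSet Ω) :
    DirichletControlled Ω (volume.restrict (Ω ∩ chart L '' Ioo s₁ s₂ ×ˢ Ioo t₁ t₂))
      (volume.restrict (chart L '' Ioo s₁ s₂ ×ˢ Ioo t₂ t₃)) := by
  have hA : MeasurableSet (chart L ⁻¹' Ω ∩ Ioo s₁ s₂ ×ˢ Ioo t₁ t₂) :=
    ((chart L).continuous.measurable hΩ).inter (measurableSet_Ioo.prod measurableSet_Ioo)
  have := isFiniteMeasure_restrict_of_subset_Ioo_prod_Ioo
    (inter_subset_right : chart L ⁻¹' Ω ∩ Ioo s₁ s₂ ×ˢ Ioo t₁ t₂ ⊆ _)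
  rw [← image_preimage_inter, ← map_chart_restrict]
  refine h.dirichletControlled_map hΩ _ ?_ measure_Ioo_lt_top.ne
    (map_fst_restrict_le inter_subset_right)
  filter_upwards [ae_restrict_mem hA] with p ⟨hpΩ, hps, hpt⟩
  have hpt₃ := hpt.2.trans h.level_lt
  exact ⟨hps, ((h.mem_iff p ⟨hps, hpt.1, hpt₃⟩).1 hpΩ).le, hpt₃.le⟩

lemma frontier_inter_subset (h : IsGraphRectangle (chart L ⁻¹' Ω) γ s₁ s₂ t₁ t₂ t₃)
    (hγ : Continuous γ) :
    frontier Ω ∩ chart L '' Ioo s₁ s₂ ×ˢ Ioo t₁ t₂ ⊆ (fun s => chart L (s, γ s)) '' Ioo s₁ s₂ := by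
  rintro _ ⟨hfr, ⟨s, t⟩, ⟨hs, ht⟩, rfl⟩
  have hfr' : (s, t) ∈ frontier (chart L ⁻¹' Ω) :=
    ((chart L).toHomeomorph.preimage_frontier Ω).subset hfr
  have on_graph : γ s = t := graph_eq_of_mem_frontier hγ (isOpen_Ioo.prod isOpen_Ioo)
    h.mem_iff hfr' ⟨hs, ht.1, ht.2.trans h.level_lt⟩
  exact ⟨s, hs, by simp only [on_graph]⟩

lemma hausdorffMeasure_restrict_le (h : IsGraphRectangle (chart L ⁻¹' Ω) γ s₁ s₂ t₁ t₂ t₃)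
    {K : ℝ≥0} (hγ : LipschitzWith K γ) :
    (Measure.hausdorffMeasure 1).restrict (frontier Ω ∩ chart L '' Ioo s₁ s₂ ×ˢ Ioo t₁ t₂)
      ≤ (1 + K) • (volume.restrict (Ioo s₁ s₂)).map fun s => chart L (s, γ s) := by
  have := hausdorffMeasure_restrict_image_le (lipschitzWith_chart_graph L hγ) zero_le_one
    (Ioo s₁ s₂)
  rw [hausdorffMeasure_real, ENNReal.rpow_one] at this
  exact (Measure.restrict_mono (h.frontier_inter_subset hγ.continuous) le_rfl).trans this

lemma dirichletControlled_hausdorffMeasure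
    (h : IsGraphRectangle (chart L ⁻¹' Ω) γ s₁ s₂ t₁ t₂ t₃) (hΩ : MeasurableSet Ω)
    {K : ℝ≥0} (hγ : LipschitzWith K γ) :
    DirichletControlled Ω
      ((Measure.hausdorffMeasure 1).restrict (frontier Ω ∩ chart L '' Ioo s₁ s₂ ×ˢ Ioo t₁ t₂))
      (volume.restrict (chart L '' Ioo s₁ s₂ ×ˢ Ioo t₂ t₃)) := by
  have graph_meas : Measurable fun s => (s, γ s) :=
    measurable_id.prodMk hγ.continuous.measurable
  have graph_mem : ∀ᵐ s ∂volume.restrict (Ioo s₁ s₂), s ∈ Ioo s₁ s₂ ∧ γ s ∈ Icc (γ s) t₃ := by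
    filter_upwards [ae_restrict_mem measurableSet_Ioo] with s hs
    exact ⟨hs, le_rfl, ((h.graph_mem s hs).2.trans h.level_lt).le⟩
  have meas : MeasurableSet {p : ℝ × ℝ | p.1 ∈ Ioo s₁ s₂ ∧ p.2 ∈ Icc (γ p.1) t₃} := by
    have hγc := hγ.continuous
    exact (measurable_fst measurableSet_Ioo).inter
      ((measurableSet_le (hγc.comp continuous_fst).measurable measurable_snd).inter
        (measurableSet_le measurable_snd measurable_const))
  have graph_control := h.dirichletControlled_map hΩ
    ((volume.restrict (Ioo s₁ s₂)).map fun s => (s, γ s))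
    ((ae_map_iff graph_meas.aemeasurable meas).2 graph_mem) ENNReal.one_ne_top
    (by simp [Measure.map_map measurable_fst graph_meas, Function.comp_def, Measure.map_id'])
  rw [Measure.map_map (chart L).continuous.measurable graph_meas] at graph_control
  exact (graph_control.smul_left (1 + K)).mono (h.hausdorffMeasure_restrict_le hγ) le_rfl

end IsGraphRectangle

end GraphRectangle

lemma closureMeasure_restrict (Ω : Set Plane) {U : Set Plane} (hU : MeasurableSet U) :
    (closureMeasure Ω).restrict U = volume.restrict (Ω ∩ U)
      + (Measure.hausdorffMeasure 1).restrict (frontier Ω ∩ U) := by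
  rw [closureMeasure, Measure.restrict_add, Measure.restrict_restrict hU,
    Measure.restrict_restrict hU, inter_comm U, inter_comm U]

lemma closureMeasure_restrict_closure (Ω : Set Plane) :
    (closureMeasure Ω).restrict (closure Ω) = closureMeasure Ω := by
  rw [closureMeasure_restrict Ω isClosed_closure.measurableSet,
    inter_eq_self_of_subset_left subset_closure,
    inter_eq_self_of_subset_left frontier_subset_closure, closureMeasure]

/-- Near `x`, the oscillation between the closure of `Ω` and some open piece of `Ω` is controlled by
the Dirichlet energy. -/
def LocallyDirichletControlled (Ω : Set Plane) (x : Plane) : Prop :=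
  ∃ U R : Set Plane, U ∈ 𝓝 x ∧ closureMeasure Ω U ≠ ⊤ ∧ IsOpen R ∧ R.Nonempty ∧ R ⊆ Ω ∧
    DirichletControlled Ω ((closureMeasure Ω).restrict U) (volume.restrict R)

lemma locallyDirichletControlled_of_mem {Ω : Set Plane} (hΩ : IsOpen Ω) {x : Plane} (hx : x ∈ Ω) :
    LocallyDirichletControlled Ω x := by
  obtain ⟨U, hUΩ, hU, hxU, hfin, hctl⟩ := exists_isOpen_dirichletControlled_self hΩ hx
  have restrict_eq : (closureMeasure Ω).restrict U = volume.restrict U := by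
    rw [closureMeasure_restrict Ω hU.measurableSet, inter_eq_self_of_subset_right hUΩ,
      ((disjoint_frontier_iff_isOpen.2 hΩ).mono_right hUΩ).inter_eq, Measure.restrict_empty,
      add_zero]
  refine ⟨U, U, hU.mem_nhds hxU, ?_, hU, ⟨x, hxU⟩, hUΩ, restrict_eq ▸ hctl⟩
  rwa [← Measure.restrict_apply_univ, restrict_eq, Measure.restrict_apply_univ]

lemma IsLipschitzDomain.locallyDirichletControlled_of_mem_frontier {Ω : Set Plane}
    (hΩ : IsLipschitzDomain Ω) {x : Plane} (hx : x ∈ frontier Ω) :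
    LocallyDirichletControlled Ω x := by
  obtain ⟨L, γ, K, hγ, hepi⟩ := hΩ.lipschitz_boundary x hx
  obtain ⟨p, rfl⟩ := (chart L).surjective x
  have hp : p ∈ frontier (chart L ⁻¹' Ω) := ((chart L).toHomeomorph.preimage_frontier Ω).subset hx
  have hepi' : ∀ᶠ q in 𝓝 p, q ∈ chart L ⁻¹' Ω ↔ γ q.1 < q.2 := by
    filter_upwards [(chart L).continuous.continuousAt.eventually hepi] with q hq
    rwa [apply_chart_zero, apply_chart_one] at hq
  obtain ⟨s₁, s₂, t₁, t₂, t₃, hmem, h⟩ := exists_isGraphRectangle hγ.continuous hp hepi'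
  have hU : IsOpen (chart L '' Ioo s₁ s₂ ×ˢ Ioo t₁ t₂) :=
    (chart L).isOpenMap _ (isOpen_Ioo.prod isOpen_Ioo)
  refine ⟨chart L '' Ioo s₁ s₂ ×ˢ Ioo t₁ t₂, chart L '' Ioo s₁ s₂ ×ˢ Ioo t₂ t₃,
    hU.mem_nhds (mem_image_of_mem _ hmem), ?_, (chart L).isOpenMap _ (isOpen_Ioo.prod isOpen_Ioo),
    ?_, h.image_upper_subset, ?_⟩
  · rw [← Measure.restrict_apply_univ, closureMeasure_restrict Ω hU.measurableSet,
      Measure.add_apply]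
    refine ENNReal.add_ne_top.2 ⟨?_, ne_top_of_le_ne_top (measure_ne_top _ univ)
      (h.hausdorffMeasure_restrict_le hγ univ)⟩
    rw [Measure.restrict_apply_univ]
    exact (hΩ.isBounded.subset inter_subset_left).measure_lt_top.ne
  · exact ((nonempty_Ioo.2 (hmem.1.1.trans hmem.1.2)).prod (nonempty_Ioo.2 h.level_lt)).image _
  · rw [closureMeasure_restrict Ω hU.measurableSet]
    exact (h.dirichletControlled_volume hΩ.isOpen.measurableSet).add_left
      (h.dirichletControlled_hausdorffMeasure hΩ.isOpen.measurableSet hγ)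

section Chaining

variable {Ω : Set Plane}

lemma measurable_of_contDiff_one {E : Type*} [NormedAddCommGroup E] [NormedSpace ℝ E]
    [MeasurableSpace E] [OpensMeasurableSpace E] :
    ∀ f ∈ {f : E → ℝ | ContDiff ℝ 1 f}, Measurable f :=
  fun _ (hf : ContDiff ℝ 1 _) => hf.continuous.measurable

lemma DirichletControlled.trans_of_inter_nonempty {R V : Set Plane} {μ ν : Measure Plane}
    [IsFiniteMeasure μ] [IsFiniteMeasure ν] (hR : IsOpen R) (hV : IsOpen V)
    (hRV : (R ∩ V).Nonempty) (hfin : volume R ≠ ⊤) (h : DirichletControlled Ω μ (volume.restrict R))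
    (h' : DirichletControlled Ω (volume.restrict V) ν) : DirichletControlled Ω μ ν := by
  have : IsFiniteMeasure (volume.restrict (R ∩ V)) :=
    isFiniteMeasure_restrict.2 (measure_ne_top_of_subset inter_subset_left hfin)
  have ne_zero : volume.restrict (R ∩ V) ≠ 0 := fun h0 =>
    (hR.inter hV).measure_ne_zero volume hRV (Measure.restrict_eq_zero.1 h0)
  exact (h.mono le_rfl (Measure.restrict_mono inter_subset_left le_rfl)).trans
    measurable_of_contDiff_one ne_zero
    (h'.mono (Measure.restrict_mono inter_subset_right le_rfl) le_rfl)

theorem exists_dirichletControlled_base (hΩ : IsOpen Ω) (hconn : IsConnected Ω) :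
    ∃ B ⊆ Ω, IsOpen B ∧ B.Nonempty ∧ ∀ x ∈ Ω, ∃ V ⊆ Ω, IsOpen V ∧ x ∈ V ∧
      DirichletControlled Ω (volume.restrict V) (volume.restrict B) := by
  obtain ⟨x₀, hx₀⟩ := hconn.nonempty
  obtain ⟨B, hBΩ, hB, hx₀B, hBfin, hBB⟩ := exists_isOpen_dirichletControlled_self hΩ hx₀
  set 𝒱 : Set (Set Plane) :=
    {V | V ⊆ Ω ∧ IsOpen V ∧ DirichletControlled Ω (volume.restrict V) (volume.restrict B)}
  suffices hcover : Ω ⊆ ⋃₀ 𝒱 by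
    refine ⟨B, hBΩ, hB, ⟨x₀, hx₀B⟩, fun x hx => ?_⟩
    obtain ⟨V, ⟨hVΩ, hV, hctl⟩, hxV⟩ := hcover hx
    exact ⟨V, hVΩ, hV, hxV, hctl⟩
  refine hconn.isPreconnected.subset_of_closure_inter_subset (isOpen_sUnion fun V hV => hV.2.1)
    ⟨x₀, hx₀, B, ⟨hBΩ, hB, hBB⟩, hx₀B⟩ ?_
  rintro x ⟨hx, hxΩ⟩
  obtain ⟨U, hUΩ, hU, hxU, hUfin, hUU⟩ := exists_isOpen_dirichletControlled_self hΩ hxΩ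
  obtain ⟨y, hyU, V, ⟨-, hV, hVB⟩, hyV⟩ := mem_closure_iff.1 hx U hU hxU
  have : IsFiniteMeasure (volume.restrict U) := isFiniteMeasure_restrict.2 hUfin
  have : IsFiniteMeasure (volume.restrict B) := isFiniteMeasure_restrict.2 hBfin
  exact ⟨U, ⟨hUΩ, hU, hUU.trans_of_inter_nonempty hU hV ⟨y, hyU, hyV⟩ hUfin hVB⟩, hxU⟩

theorem dirichletControlled_closureMeasure (hΩ : IsOpen Ω) (hconn : IsConnected Ω)
    (hbdd : Bornology.IsBounded Ω) (hloc : ∀ x ∈ closure Ω, LocallyDirichletControlled Ω x) :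
    IsFiniteMeasure (closureMeasure Ω) ∧
      DirichletControlled Ω (closureMeasure Ω) (closureMeasure Ω) := by
  have hfin : volume Ω ≠ ⊤ := hbdd.measure_lt_top.ne
  obtain ⟨B, hBΩ, hB, hBne, hbase⟩ := exists_dirichletControlled_base hΩ hconn
  have finite_of_subset {V} (hV : V ⊆ Ω) : IsFiniteMeasure (volume.restrict V) :=
    isFiniteMeasure_restrict.2 (measure_ne_top_of_subset hV hfin)
  have := finite_of_subset hBΩ
  have on_compact : closureMeasure Ω (closure Ω) < ⊤ ∧
      DirichletControlled Ω ((closureMeasure Ω).restrict (closure Ω)) (volume.restrict B) := by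
    refine hbdd.isCompact_closure.induction_on (p := fun s => closureMeasure Ω s < ⊤ ∧
      DirichletControlled Ω ((closureMeasure Ω).restrict s) (volume.restrict B))
      ⟨by simp, by simpa using OscControlled.zero_left⟩ ?_ ?_ fun x hx => ?_
    · exact fun s t hst h => ⟨(measure_mono hst).trans_lt h.1,
        h.2.mono (Measure.restrict_mono hst le_rfl) le_rfl⟩
    · exact fun s t hs ht => ⟨measure_union_lt_top hs.1 ht.1,
        (hs.2.add_left ht.2).mono (Measure.restrict_union_le s t) le_rfl⟩
    · obtain ⟨U, R, hU, hUfin, hR, ⟨y, hyR⟩, hRΩ, hUR⟩ := hloc x hx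
      obtain ⟨V, -, hV, hyV, hVB⟩ := hbase y (hRΩ hyR)
      have : IsFiniteMeasure ((closureMeasure Ω).restrict U) := isFiniteMeasure_restrict.2 hUfin
      exact ⟨U, mem_nhdsWithin_of_mem_nhds hU, hUfin.lt_top, hUR.trans_of_inter_nonempty hR hV
        ⟨y, hyR, hyV⟩ (measure_ne_top_of_subset hRΩ hfin) hVB⟩
  rw [closureMeasure_restrict_closure, ← Measure.restrict_apply_univ,
    closureMeasure_restrict_closure] at on_compact
  have finite : IsFiniteMeasure (closureMeasure Ω) := ⟨on_compact.1⟩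
  exact ⟨finite, on_compact.2.trans_of_inter_nonempty hB hB (by simpa using hBne)
    (measure_ne_top_of_subset hBΩ hfin) (on_compact.2.symm measurable_of_contDiff_one)⟩

end Chaining

theorem IsLipschitzDomain.poincare {Ω : Set Plane} (hΩ : IsLipschitzDomain Ω) :
    IsFiniteMeasure (closureMeasure Ω) ∧
      DirichletControlled Ω (closureMeasure Ω) (closureMeasure Ω) := by
  refine dirichletControlled_closureMeasure hΩ.isOpen hΩ.isConnected hΩ.isBounded fun x hx => ?_
  rw [closure_eq_self_union_frontier] at hx
  exact hx.elim (locallyDirichletControlled_of_mem hΩ.isOpen)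
    hΩ.locallyDirichletControlled_of_mem_frontier

section Slices

variable {E : Type*} [NormedAddCommGroup E]

/-- The derivative of `ψ` along the axis. -/
noncomputable def sliceDeriv (ψ : E × ℝ → ℝ) (y : E × ℝ) : ℝ :=
  deriv (fun z => ψ (y.1, z)) y.2

section SliceDeriv

variable [NormedSpace ℝ E] {ψ φ : E × ℝ → ℝ}

lemma sliceDeriv_apply (hψ : ContDiff ℝ 1 ψ) (y : E × ℝ) :
    sliceDeriv ψ y = fderiv ℝ ψ y (0, 1) := by
  have chain := ((hψ.differentiable one_ne_zero y).hasFDerivAt.comp y.2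
    (hasFDerivAt_prodMk_right y.1 y.2)).hasDerivAt.deriv
  simpa [Function.comp_def, sliceDeriv] using chain

lemma continuous_sliceDeriv (hψ : ContDiff ℝ 1 ψ) : Continuous (sliceDeriv ψ) := by
  have : Continuous (fderiv ℝ ψ) := hψ.continuous_fderiv one_ne_zero
  rw [funext (sliceDeriv_apply hψ)]
  fun_prop

lemma sliceDeriv_add (hψ : ContDiff ℝ 1 ψ) (hφ : ContDiff ℝ 1 φ) :
    sliceDeriv (ψ + φ) = sliceDeriv ψ + sliceDeriv φ := by
  funext y
  rw [Pi.add_apply, sliceDeriv_apply hψ, sliceDeriv_apply hφ,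
    sliceDeriv_apply (ψ := ψ + φ) (hψ.add hφ),
    fderiv_add (hψ.differentiable one_ne_zero y) (hφ.differentiable one_ne_zero y), add_apply]

lemma sliceDeriv_smul (hψ : ContDiff ℝ 1 ψ) (c : ℝ) :
    sliceDeriv (c • ψ) = c • sliceDeriv ψ := by
  funext y
  rw [Pi.smul_apply, sliceDeriv_apply hψ, sliceDeriv_apply (ψ := c • ψ) (hψ.const_smul c),
    fderiv_const_smul (hψ.differentiable one_ne_zero y), smul_apply]

end SliceDeriv

variable [InnerProductSpace ℝ E] [CompleteSpace E] {ψ φ : E × ℝ → ℝ}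

/-- The cross-sectional gradient of `ψ`. -/
noncomputable def sliceGrad (ψ : E × ℝ → ℝ) (y : E × ℝ) : E :=
  gradient (fun x => ψ (x, y.2)) y.1

lemma sliceGrad_eq (hψ : ContDiff ℝ 1 ψ) (y : E × ℝ) :
    sliceGrad ψ y = (InnerProductSpace.toDual ℝ E).symm
      ((fderiv ℝ ψ y).comp (ContinuousLinearMap.inl ℝ E ℝ)) := by
  have chain : HasFDerivAt (fun x => ψ (x, y.2))
      ((fderiv ℝ ψ y).comp (ContinuousLinearMap.inl ℝ E ℝ)) y.1 :=
    (hψ.differentiable one_ne_zero y).hasFDerivAt.comp y.1 (hasFDerivAt_prodMk_left y.1 y.2)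
  rw [sliceGrad, gradient, chain.fderiv]

lemma inner_sliceGrad (hψ : ContDiff ℝ 1 ψ) (y : E × ℝ) (e : E) :
    inner ℝ (sliceGrad ψ y) e = fderiv ℝ ψ y (e, 0) := by
  rw [sliceGrad_eq hψ, InnerProductSpace.toDual_symm_apply, ContinuousLinearMap.comp_apply,
    ContinuousLinearMap.inl_apply]

lemma continuous_sliceGrad (hψ : ContDiff ℝ 1 ψ) : Continuous (sliceGrad ψ) := by
  have : Continuous (fderiv ℝ ψ) := hψ.continuous_fderiv one_ne_zero
  rw [funext (sliceGrad_eq hψ)]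
  fun_prop

lemma sliceGrad_add (hψ : ContDiff ℝ 1 ψ) (hφ : ContDiff ℝ 1 φ) :
    sliceGrad (ψ + φ) = sliceGrad ψ + sliceGrad φ := by
  funext y
  rw [Pi.add_apply, sliceGrad_eq hψ, sliceGrad_eq hφ, sliceGrad_eq (ψ := ψ + φ) (hψ.add hφ),
    fderiv_add (hψ.differentiable one_ne_zero y) (hφ.differentiable one_ne_zero y),
    ContinuousLinearMap.add_comp, map_add]

lemma sliceGrad_smul (hψ : ContDiff ℝ 1 ψ) (c : ℝ) : sliceGrad (c • ψ) = c • sliceGrad ψ := by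
  funext y
  rw [Pi.smul_apply, sliceGrad_eq hψ, sliceGrad_eq (ψ := c • ψ) (hψ.const_smul c),
    fderiv_const_smul (hψ.differentiable one_ne_zero y), ContinuousLinearMap.smul_comp, map_smul]

end Slices

section CylinderPoincare

variable {Ω : Set Plane} {z₁ z₂ : ℝ}

/-- The Dirichlet energy of `ψ` on the cylinder over `Ω`. -/
noncomputable def cylinderEnergy (Ω : Set Plane) (z₁ z₂ : ℝ) (ψ : Space → ℝ) : ℝ≥0∞ :=
  (∫⁻ y in cylinder Ω z₁ z₂, ‖sliceGrad ψ y‖ₑ ^ 2) + ∫⁻ y in cylinder Ω z₁ z₂, ‖sliceDeriv ψ y‖ₑ ^ 2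

/-- The oscillation of continuously differentiable functions between `μ` and `ν` is bounded by
their Dirichlet energy on the cylinder over `Ω`, up to a constant. -/
abbrev CylinderControlled (Ω : Set Plane) (z₁ z₂ : ℝ) (μ ν : Measure Space) : Prop :=
  OscControlled {ψ | ContDiff ℝ 1 ψ} (cylinderEnergy Ω z₁ z₂) μ ν

/-- The length measure on `(z₁, z₂)` together with unit masses at the end points, used to treat
the interior and the two end sections of the cylinder at once. -/
noncomputable def intervalMeasure (z₁ z₂ : ℝ) : Measure ℝ :=
  volume.restrict (Ioo z₁ z₂) + Measure.dirac z₁ + Measure.dirac z₂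

instance : IsFiniteMeasure (intervalMeasure z₁ z₂) := by
  unfold intervalMeasure
  infer_instance

lemma ae_intervalMeasure_mem_Icc (hz : z₁ ≤ z₂) : ∀ᵐ z ∂intervalMeasure z₁ z₂, z ∈ Icc z₁ z₂ := by
  simp only [intervalMeasure, ae_add_measure_iff, ae_dirac_eq, eventually_pure]
  exact ⟨⟨(ae_restrict_mem measurableSet_Ioo).mono fun _ => (Ioo_subset_Icc_self ·),
    left_mem_Icc.2 hz⟩, right_mem_Icc.2 hz⟩

lemma volume_restrict_cylinder (Ω : Set Plane) (z₁ z₂ : ℝ) :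
    volume.restrict (cylinder Ω z₁ z₂)
      = (volume.restrict Ω).prod (volume.restrict (Ioo z₁ z₂)) := by
  rw [cylinder, Measure.volume_eq_prod, Measure.prod_restrict]

lemma volume_add_boundaryMeasure_le [IsFiniteMeasure (closureMeasure Ω)] :
    volume.restrict (cylinder Ω z₁ z₂) + boundaryMeasure Ω z₁ z₂
      ≤ (volume.restrict Ω).prod (intervalMeasure z₁ z₂)
        + (closureMeasure Ω).prod (volume.restrict (Ioo z₁ z₂)) := by
  have : IsFiniteMeasure (volume.restrict Ω) :=
    isFiniteMeasure_of_le (closureMeasure Ω) (Measure.le_add_right le_rfl)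
  have : IsFiniteMeasure ((Measure.hausdorffMeasure 1).restrict (frontier Ω)) :=
    isFiniteMeasure_of_le (closureMeasure Ω) (Measure.le_add_left le_rfl)
  rw [volume_restrict_cylinder, boundaryMeasure, intervalMeasure, closureMeasure]
  simp only [Measure.prod_add, Measure.add_prod]
  set μ := (volume.restrict Ω).prod (volume.restrict (Ioo z₁ z₂))
  calc _ ≤ _ := Measure.le_add_right (ν' := μ) le_rfl
    _ = _ := by abel

lemma oscillation_le_lintegral_deriv {f : ℝ → ℝ} (hf : ContDiff ℝ 1 f) {a b : ℝ}
    {μ ν : Measure ℝ} (hμ : ∀ᵐ s ∂μ, s ∈ Icc a b) (hν : ∀ᵐ t ∂ν, t ∈ Icc a b) :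
    oscillation f μ ν
      ≤ μ univ * ν univ * ENNReal.ofReal (b - a) * ∫⁻ θ in Ioo a b, ‖deriv f θ‖ₑ ^ 2 := by
  calc oscillation f μ ν
      ≤ ∫⁻ _, ∫⁻ _, ENNReal.ofReal (b - a) * (∫⁻ θ in Ioo a b, ‖deriv f θ‖ₑ ^ 2) ∂ν ∂μ :=
        lintegral_mono_ae <| hμ.mono fun s hs => lintegral_mono_ae <| hν.mono fun t ht =>
          enorm_sub_sq_le_lintegral_deriv hf hs ht
    _ = _ := by
        rw [lintegral_const, lintegral_const]
        ring

lemma lintegral_oscillation_slice_right_le {ψ : Space → ℝ} (hψ : ContDiff ℝ 1 ψ) {μ ν : Measure ℝ}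
    (hμ : ∀ᵐ z ∂μ, z ∈ Icc z₁ z₂) (hν : ∀ᵐ z ∂ν, z ∈ Icc z₁ z₂) :
    ∫⁻ x in Ω, oscillation (fun z => ψ (x, z)) μ ν
      ≤ μ univ * ν univ * ENNReal.ofReal (z₂ - z₁) * cylinderEnergy Ω z₁ z₂ ψ := by
  have meas := (continuous_sliceDeriv hψ).measurable.enorm.pow_const 2
  calc ∫⁻ x in Ω, oscillation (fun z => ψ (x, z)) μ ν
      ≤ ∫⁻ x in Ω, μ univ * ν univ * ENNReal.ofReal (z₂ - z₁) *
          ∫⁻ z in Ioo z₁ z₂, ‖sliceDeriv ψ (x, z)‖ₑ ^ 2 :=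
        lintegral_mono fun x => oscillation_le_lintegral_deriv (by fun_prop) hμ hν
    _ = μ univ * ν univ * ENNReal.ofReal (z₂ - z₁) *
          ∫⁻ y in cylinder Ω z₁ z₂, ‖sliceDeriv ψ y‖ₑ ^ 2 := by
        rw [volume_restrict_cylinder, lintegral_prod _ meas.aemeasurable,
          lintegral_const_mul _ meas.lintegral_prod_right']
    _ ≤ _ := by
        gcongr
        exact le_add_self

lemma lintegral_oscillation_slice_left_le {ψ : Space → ℝ} (hψ : ContDiff ℝ 1 ψ)
    {μ ν : Measure Plane} {C : ℝ≥0∞}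
    (hC : ∀ f ∈ {f : Plane → ℝ | ContDiff ℝ 1 f}, oscillation f μ ν ≤ C * dirichletEnergy Ω f) :
    ∫⁻ z in Ioo z₁ z₂, oscillation (fun x => ψ (x, z)) μ ν ≤ C * cylinderEnergy Ω z₁ z₂ ψ := by
  have meas := (continuous_sliceGrad hψ).measurable.enorm.pow_const 2
  have energy_eq : ∀ z, dirichletEnergy Ω (fun x => ψ (x, z))
      = ∫⁻ x in Ω, ‖sliceGrad ψ (x, z)‖ₑ ^ 2 := fun z =>
    lintegral_congr fun x => by rw [sliceGrad, gradient, LinearIsometryEquiv.enorm_map]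
  calc ∫⁻ z in Ioo z₁ z₂, oscillation (fun x => ψ (x, z)) μ ν
      ≤ ∫⁻ z in Ioo z₁ z₂, C * ∫⁻ x in Ω, ‖sliceGrad ψ (x, z)‖ₑ ^ 2 :=
        lintegral_mono fun z =>
          (hC _ (show ContDiff ℝ 1 fun x => ψ (x, z) by fun_prop)).trans_eq (by rw [energy_eq])
    _ = C * ∫⁻ y in cylinder Ω z₁ z₂, ‖sliceGrad ψ y‖ₑ ^ 2 := by
        rw [volume_restrict_cylinder, lintegral_prod_symm _ meas.aemeasurable,
          lintegral_const_mul _ meas.lintegral_prod_left']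
    _ ≤ _ := by
        gcongr
        exact le_self_add

lemma DirichletControlled.prod {ν : Measure Plane} {κ : Measure ℝ} [IsFiniteMeasure ν]
    [IsFiniteMeasure κ] (h : DirichletControlled Ω (volume.restrict Ω) ν)
    (hκ : ∀ᵐ z ∂κ, z ∈ Icc z₁ z₂) :
    CylinderControlled Ω z₁ z₂ ((volume.restrict Ω).prod κ)
      (ν.prod (volume.restrict (Ioo z₁ z₂))) := by
  obtain ⟨C, hC, hle⟩ := h
  set I : Measure ℝ := volume.restrict (Ioo z₁ z₂)
  refine ⟨2 * (ν univ * (κ univ * I univ * ENNReal.ofReal (z₂ - z₁)) + κ univ * C), by finiteness,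
    fun ψ (hψ : ContDiff ℝ 1 ψ) => ?_⟩
  have hI : ∀ᵐ z ∂I, z ∈ Icc z₁ z₂ :=
    (ae_restrict_mem measurableSet_Ioo).mono fun _ => (Ioo_subset_Icc_self ·)
  calc oscillation ψ ((volume.restrict Ω).prod κ) (ν.prod I)
      ≤ 2 * (ν univ * (κ univ * I univ * ENNReal.ofReal (z₂ - z₁) * cylinderEnergy Ω z₁ z₂ ψ)
          + κ univ * (C * cylinderEnergy Ω z₁ z₂ ψ)) := by
        grw [oscillation_prod_le hψ.continuous.measurable,
          lintegral_oscillation_slice_right_le hψ hκ hI,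
          lintegral_oscillation_slice_left_le hψ hle]
    _ = _ := by ring

lemma OscControlled.add_add {X : Type*} [MeasurableSpace X] {F : Set (X → ℝ)}
    {E : (X → ℝ) → ℝ≥0∞} {μ ν : Measure X} [IsFiniteMeasure μ] [IsFiniteMeasure ν]
    (hF : ∀ f ∈ F, Measurable f) (hμ : μ ≠ 0) (hν : ν ≠ 0) (h : OscControlled F E μ ν) :
    OscControlled F E (μ + ν) (μ + ν) := by
  have h' := h.symm hF
  have to_left : OscControlled F E (μ + ν) μ := (h.trans hF hν h').add_left h'
  have to_right : OscControlled F E (μ + ν) ν := h.add_left (h'.trans hF hμ h)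
  exact (to_left.symm hF).add_left (to_right.symm hF)

theorem IsLipschitzDomain.cylinder_poincare (hΩ : IsLipschitzDomain Ω) (hz : z₁ < z₂) :
    CylinderControlled Ω z₁ z₂ (volume.restrict (cylinder Ω z₁ z₂) + boundaryMeasure Ω z₁ z₂)
      (volume.restrict (cylinder Ω z₁ z₂) + boundaryMeasure Ω z₁ z₂) := by
  obtain ⟨finite, planar⟩ := hΩ.poincare
  have volume_le : volume.restrict Ω ≤ closureMeasure Ω := Measure.le_add_right le_rfl
  have := isFiniteMeasure_of_le _ volume_le
  have hΩ0 : volume Ω ≠ 0 := hΩ.isOpen.measure_ne_zero _ hΩ.isConnected.nonempty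
  have prod_ne_zero : (volume.restrict Ω).prod (intervalMeasure z₁ z₂) ≠ 0 := by
    rw [← Measure.measure_univ_ne_zero, ← univ_prod_univ, Measure.prod_prod]
    simp [hΩ0, intervalMeasure]
  have prod_ne_zero' : (closureMeasure Ω).prod (volume.restrict (Ioo z₁ z₂)) ≠ 0 := by
    rw [← Measure.measure_univ_ne_zero, ← univ_prod_univ, Measure.prod_prod]
    simp [hΩ0, closureMeasure, hz]
  have between_products := DirichletControlled.prod (planar.mono volume_le le_rfl)
    (ae_intervalMeasure_mem_Icc hz.le)
  exact (between_products.add_add measurable_of_contDiff_one prod_ne_zero prod_ne_zero').mono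
    volume_add_boundaryMeasure_le volume_add_boundaryMeasure_le

end CylinderPoincare

namespace OscControlled

variable {X : Type*} [MeasurableSpace X] {F : Set (X → ℝ)} {E : (X → ℝ) → ℝ≥0∞}
  {μ ν : Measure X}

lemma lintegral_sq_mul_le {f : X → ℝ} (hf : Measurable f) (μ ν : Measure X) :
    ν univ * ∫⁻ x, ‖f x‖ₑ ^ 2 ∂μ ≤ 2 * (oscillation f μ ν + μ univ * ∫⁻ y, ‖f y‖ₑ ^ 2 ∂ν) := by
  calc ν univ * ∫⁻ x, ‖f x‖ₑ ^ 2 ∂μ = ∫⁻ x, ∫⁻ _, ‖f x‖ₑ ^ 2 ∂ν ∂μ := by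
        simp only [lintegral_const]
        rw [lintegral_mul_const _ (by fun_prop), mul_comm]
    _ ≤ ∫⁻ x, ∫⁻ y, 2 * (‖f x - f y‖ₑ ^ 2 + ‖f y‖ₑ ^ 2) ∂ν ∂μ := by
        refine lintegral_mono fun x => lintegral_mono fun y => ?_
        simpa using enorm_sub_sq_le (f x) (f y) 0
    _ = _ := by
        simp_rw [lintegral_const_mul' 2 _ (by simp : (2 : ℝ≥0∞) ≠ ⊤), mul_comm (μ univ),
          ← lintegral_const, oscillation]
        rw [← lintegral_add_right _ measurable_const]
        exact congrArg _ (lintegral_congr fun x => lintegral_add_right _ (by fun_prop))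

theorem friedrichs [IsFiniteMeasure μ] [IsFiniteMeasure ν] (hF : ∀ f ∈ F, Measurable f)
    (hν : ν ≠ 0) (h : OscControlled F E μ ν) :
    ∃ C : ℝ≥0∞, C ≠ ⊤ ∧
      ∀ f ∈ F, ∫⁻ x, ‖f x‖ₑ ^ 2 ∂μ ≤ C * (E f + ∫⁻ x, ‖f x‖ₑ ^ 2 ∂ν) := by
  obtain ⟨C, hC, hle⟩ := h
  have hν0 : ν univ ≠ 0 := by simpa using hν
  refine ⟨(ν univ)⁻¹ * (2 * (C + μ univ)), by finiteness, fun f hf => ?_⟩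
  calc ∫⁻ x, ‖f x‖ₑ ^ 2 ∂μ = (ν univ)⁻¹ * (ν univ * ∫⁻ x, ‖f x‖ₑ ^ 2 ∂μ) := by
        rw [← mul_assoc, ENNReal.inv_mul_cancel hν0 (measure_ne_top _ _), one_mul]
    _ ≤ (ν univ)⁻¹ * (2 * (C * E f + μ univ * ∫⁻ y, ‖f y‖ₑ ^ 2 ∂ν)) := by
        grw [lintegral_sq_mul_le (hF f hf), hle f hf]
    _ ≤ (ν univ)⁻¹ * (2 * (C * (E f + ∫⁻ y, ‖f y‖ₑ ^ 2 ∂ν)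
          + μ univ * (E f + ∫⁻ y, ‖f y‖ₑ ^ 2 ∂ν))) := by
        gcongr
        · exact le_self_add
        · exact le_add_self
    _ = _ := by ring

end OscControlled

section BoundaryMeasure

variable {Ω : Set Plane} {z₁ z₂ : ℝ}

lemma memLp_top_cylinder {f : Plane → ℝ} (hf : MemLp f ⊤ (volume.restrict Ω)) :
    MemLp (fun y : Space => f y.1) ⊤ (volume.restrict (cylinder Ω z₁ z₂)) := by
  rw [volume_restrict_cylinder]
  exact hf.comp_fst _

lemma ae_cylinder {p : Plane → Prop} (h : ∀ᵐ x ∂volume.restrict Ω, p x) :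
    ∀ᵐ y ∂volume.restrict (cylinder Ω z₁ z₂), p y.1 := by
  rw [volume_restrict_cylinder]
  exact Measure.quasiMeasurePreserving_fst.ae h

instance [IsFiniteMeasure (volume.restrict Ω)] :
    IsFiniteMeasure (volume.restrict (cylinder Ω z₁ z₂)) := by
  rw [volume_restrict_cylinder]
  infer_instance

instance [IsFiniteMeasure (volume.restrict Ω)]
    [IsFiniteMeasure ((Measure.hausdorffMeasure 1 : Measure Plane).restrict (frontier Ω))] :
    IsFiniteMeasure (boundaryMeasure Ω z₁ z₂) := by
  rw [boundaryMeasure]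
  infer_instance

lemma IsLipschitzDomain.isFiniteMeasure_volume (hΩ : IsLipschitzDomain Ω) :
    IsFiniteMeasure (volume.restrict Ω) :=
  isFiniteMeasure_restrict.2 hΩ.isBounded.measure_lt_top.ne

lemma IsLipschitzDomain.isFiniteMeasure_frontier (hΩ : IsLipschitzDomain Ω) :
    IsFiniteMeasure ((Measure.hausdorffMeasure 1 : Measure Plane).restrict (frontier Ω)) :=
  have := hΩ.poincare.1
  isFiniteMeasure_of_le (closureMeasure Ω) (Measure.le_add_left le_rfl)

section Restrict

variable [SFinite ((Measure.hausdorffMeasure 1 : Measure Plane).restrict (frontier Ω))]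

lemma boundaryMeasure_restrict_prod (A : Set Plane) {B : Set ℝ} [Decidable (z₁ ∈ B)]
    [Decidable (z₂ ∈ B)] (hB : MeasurableSet B) :
    (boundaryMeasure Ω z₁ z₂).restrict (A ×ˢ B)
      = (((Measure.hausdorffMeasure 1).restrict (frontier Ω)).restrict A).prod
          ((volume.restrict (Ioo z₁ z₂)).restrict B)
        + ((volume.restrict Ω).restrict A).prod (if z₁ ∈ B then Measure.dirac z₁ else 0)
        + ((volume.restrict Ω).restrict A).prod (if z₂ ∈ B then Measure.dirac z₂ else 0) := by
  rw [boundaryMeasure, Measure.restrict_add, Measure.restrict_add, ← Measure.prod_restrict,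
    ← Measure.prod_restrict, ← Measure.prod_restrict, restrict_dirac' hB, restrict_dirac' hB]

lemma boundaryMeasure_restrict_lateral {G : Set Plane} (hG : G ⊆ frontier Ω) :
    (boundaryMeasure Ω z₁ z₂).restrict (G ×ˢ Ioo z₁ z₂)
      = ((Measure.hausdorffMeasure 1).restrict G).prod (volume.restrict (Ioo z₁ z₂)) := by
  classical
  simp [boundaryMeasure_restrict_prod G measurableSet_Ioo,
    Measure.restrict_restrict_of_subset hG, Measure.restrict_restrict_of_subset Subset.rfl]

lemma ae_lateral {G : Set Plane} (hG : G ⊆ frontier Ω) (hGm : MeasurableSet G)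
    {p : Plane → Prop} (h : ∀ᵐ x ∂(Measure.hausdorffMeasure 1).restrict G, p x) :
    ∀ᵐ y ∂boundaryMeasure Ω z₁ z₂, y ∈ G ×ˢ Ioo z₁ z₂ → p y.1 := by
  rw [← ae_restrict_iff' (hGm.prod measurableSet_Ioo), boundaryMeasure_restrict_lateral hG]
  exact Measure.quasiMeasurePreserving_fst.ae h

lemma memLp_top_indicator_lateral {G : Set Plane} (hG : G ⊆ frontier Ω) (hGm : MeasurableSet G)
    {f : Plane → ℝ} (hf : MemLp f ⊤ ((Measure.hausdorffMeasure 1).restrict G)) :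
    MemLp ((G ×ˢ Ioo z₁ z₂).indicator fun y => f y.1) ⊤ (boundaryMeasure Ω z₁ z₂) := by
  rw [memLp_indicator_iff_restrict (hGm.prod measurableSet_Ioo),
    boundaryMeasure_restrict_lateral hG]
  exact hf.comp_fst _

lemma boundaryMeasure_restrict_section (hΩ : IsOpen Ω) (hz : z₁ < z₂) {z : ℝ}
    (hz_end : z = z₁ ∨ z = z₂) :
    (boundaryMeasure Ω z₁ z₂).restrict (Ω ×ˢ {z}) = (volume.restrict Ω).prod (Measure.dirac z) := by
  classical
  rw [boundaryMeasure_restrict_prod Ω (measurableSet_singleton z),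
    Measure.restrict_restrict hΩ.measurableSet,
    (disjoint_frontier_iff_isOpen.2 hΩ).symm.inter_eq,
    Measure.restrict_restrict_of_subset Subset.rfl]
  rcases hz_end with rfl | rfl
  · simp [hz.ne']
  · simp [hz.ne]

lemma ae_section (hΩ : IsOpen Ω) (hz : z₁ < z₂) {z : ℝ} (hz_end : z = z₁ ∨ z = z₂)
    {p : Space → Prop} (h : ∀ᵐ x ∂volume.restrict Ω, p (x, z)) :
    ∀ᵐ y ∂boundaryMeasure Ω z₁ z₂, y ∈ Ω ×ˢ {z} → p y := by
  have at_fst : ∀ᵐ y ∂boundaryMeasure Ω z₁ z₂, y ∈ Ω ×ˢ {z} → p (y.1, z) := by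
    rw [← ae_restrict_iff' (hΩ.measurableSet.prod (measurableSet_singleton z)),
      boundaryMeasure_restrict_section hΩ hz hz_end]
    exact Measure.quasiMeasurePreserving_fst.ae h
  filter_upwards [at_fst] with ⟨x, t⟩ hy hmem
  obtain rfl : t = z := hmem.2
  exact hy hmem

lemma memLp_top_indicator_section (hΩ : IsOpen Ω) (hz : z₁ < z₂) {z : ℝ}
    (hz_end : z = z₁ ∨ z = z₂) {f : Plane → ℝ} (hf : MemLp f ⊤ (volume.restrict Ω)) :
    MemLp ((Ω ×ˢ {z}).indicator fun y => f y.1) ⊤ (boundaryMeasure Ω z₁ z₂) := by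
  rw [memLp_indicator_iff_restrict (hΩ.measurableSet.prod (measurableSet_singleton z)),
    boundaryMeasure_restrict_section hΩ hz hz_end]
  exact hf.comp_fst _

lemma integrable_section (hΩ : IsOpen Ω) (hz : z₁ < z₂) {z : ℝ} (hz_end : z = z₁ ∨ z = z₂)
    {F : Space → ℝ} (hF : Integrable F (boundaryMeasure Ω z₁ z₂)) :
    IntegrableOn (fun x => F (x, z)) Ω := by
  have on_section := hF.integrableOn (s := Ω ×ˢ {z})
  rw [IntegrableOn, boundaryMeasure_restrict_section hΩ hz hz_end, Measure.prod_dirac] at on_section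
  exact on_section.comp_measurable (by fun_prop)

lemma setIntegral_section (hΩ : IsOpen Ω) (hz : z₁ < z₂) {z : ℝ} (hz_end : z = z₁ ∨ z = z₂)
    {F : Space → ℝ} (hF : Integrable F (boundaryMeasure Ω z₁ z₂)) :
    ∫ y in Ω ×ˢ {z}, F y ∂boundaryMeasure Ω z₁ z₂ = ∫ x in Ω, F (x, z) := by
  have on_section := hF.integrableOn (s := Ω ×ˢ {z})
  rw [IntegrableOn, boundaryMeasure_restrict_section hΩ hz hz_end, Measure.prod_dirac] at on_section
  rw [boundaryMeasure_restrict_section hΩ hz hz_end, Measure.prod_dirac]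
  exact integral_map (by fun_prop) on_section.1

/-- The density `f n_z` on the boundary of the cylinder, `n` being the outward unit normal. -/
noncomputable def axialFlux (Ω : Set Plane) (z₁ z₂ : ℝ) (f : Plane → ℝ) : Space → ℝ :=
  (Ω ×ˢ {z₂}).indicator (fun y => f y.1) - (Ω ×ˢ {z₁}).indicator (fun y => f y.1)

lemma memLp_top_axialFlux (hΩ : IsOpen Ω) (hz : z₁ < z₂) {f : Plane → ℝ}
    (hf : MemLp f ⊤ (volume.restrict Ω)) :
    MemLp (axialFlux Ω z₁ z₂ f) ⊤ (boundaryMeasure Ω z₁ z₂) :=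
  (memLp_top_indicator_section hΩ hz (.inr rfl) hf).sub
    (memLp_top_indicator_section hΩ hz (.inl rfl) hf)

lemma integral_axialFlux_mul (hΩ : IsOpen Ω) (hz : z₁ < z₂) {f : Plane → ℝ} {k : Space → ℝ}
    (hfk : Integrable (fun y => axialFlux Ω z₁ z₂ f y * k y) (boundaryMeasure Ω z₁ z₂)) :
    ∫ y, axialFlux Ω z₁ z₂ f y * k y ∂boundaryMeasure Ω z₁ z₂
      = ∫ x in Ω, f x * (k (x, z₂) - k (x, z₁)) := by
  have meas (z : ℝ) : MeasurableSet (Ω ×ˢ {z}) :=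
    hΩ.measurableSet.prod (measurableSet_singleton z)
  have disj : Disjoint (Ω ×ˢ {z₂}) (Ω ×ˢ {z₁}) :=
    disjoint_prod.2 (.inr (disjoint_singleton.2 hz.ne'))
  have supp : ∀ y ∉ Ω ×ˢ {z₂} ∪ Ω ×ˢ {z₁}, axialFlux Ω z₁ z₂ f y * k y = 0 := by
    intro y hy
    rw [mem_union, not_or] at hy
    simp [axialFlux, indicator_of_notMem hy.1, indicator_of_notMem hy.2]
  rw [← setIntegral_eq_integral_of_forall_compl_eq_zero supp,
    setIntegral_union disj (meas z₁) hfk.integrableOn hfk.integrableOn,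
    setIntegral_section hΩ hz (.inr rfl) hfk, setIntegral_section hΩ hz (.inl rfl) hfk,
    ← integral_add (integrable_section hΩ hz (.inr rfl) hfk)
      (integrable_section hΩ hz (.inl rfl) hfk)]
  refine setIntegral_congr_fun hΩ.measurableSet fun x hx => ?_
  simp [axialFlux, hx, hz.ne, hz.ne']
  ring

lemma quasiMeasurePreserving_add_const {A : Set Plane} {p : Plane} (hA : A ⊆ frontier Ω)
    (hAp : (fun x => x + p) '' A ⊆ frontier Ω) :
    Measure.QuasiMeasurePreserving (fun y : Space => (y.1 + p, y.2))
      ((boundaryMeasure Ω z₁ z₂).restrict (A ×ˢ Ioo z₁ z₂)) (boundaryMeasure Ω z₁ z₂) := by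
  have sfinite : SFinite ((Measure.hausdorffMeasure 1 : Measure Plane).restrict A) := by
    rw [← Measure.restrict_restrict_of_subset hA]
    infer_instance
  have planar : Measure.QuasiMeasurePreserving (fun x : Plane => x + p)
      ((Measure.hausdorffMeasure 1).restrict A)
      ((Measure.hausdorffMeasure 1).restrict (frontier Ω)) := by
    have meas : Measurable fun x : Plane => x + p := by fun_prop
    refine ⟨meas, Measure.AbsolutelyContinuous.mk fun s hs null => ?_⟩
    rw [Measure.restrict_apply hs] at null
    rw [Measure.map_apply meas hs, Measure.restrict_apply (meas hs),
      ← (IsometryEquiv.addRight p).isometry.hausdorffMeasure_image (.inl zero_le_one)]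
    refine measure_mono_null ?_ null
    rintro _ ⟨x, ⟨hxs, hxA⟩, rfl⟩
    exact ⟨hxs, hAp ⟨x, hxA, rfl⟩⟩
  rw [boundaryMeasure_restrict_lateral hA]
  refine (QuasiMeasurePreserving.prodMap planar
    (Measure.QuasiMeasurePreserving.id (volume.restrict (Ioo z₁ z₂)))).mono_right ?_
  rw [boundaryMeasure, add_assoc]
  exact (Measure.le_add_right le_rfl).absolutelyContinuous

end Restrict

end BoundaryMeasure

section Lp

variable {α E : Type*} [MeasurableSpace α] {μ : Measure α} [NormedAddCommGroup E]

lemma ofReal_norm_sq_eq_lintegral {u : Lp E 2 μ} {u' : α → E} (hu : u =ᵐ[μ] u') :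
    ENNReal.ofReal (‖u‖ ^ 2) = ∫⁻ x, ‖u' x‖ₑ ^ 2 ∂μ := by
  rw [ENNReal.ofReal_pow (norm_nonneg u), ofReal_norm, Lp.enorm_def, eLpNorm_congr_ae hu]
  simpa using eLpNorm_nnreal_pow_eq_lintegral (μ := μ) (f := u') (p := 2) two_ne_zero

variable {p : ℝ≥0∞} {ι : Type*} {l : Filter ι}

lemma eventually_memLp_of_tendsto {f : ι → α → E} {g : α → E}
    (hf : ∀ i, AEStronglyMeasurable (f i) μ) (hg : MemLp g p μ)
    (h : Tendsto (fun i => eLpNorm (fun x => f i x - g x) p μ) l (𝓝 0)) :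
    ∀ᶠ i in l, MemLp (f i) p μ := by
  filter_upwards [h.eventually_lt_const zero_lt_one] with i hi
  have sub_memLp : MemLp (f i - g) p μ := ⟨(hf i).sub hg.1, hi.trans ENNReal.one_lt_top⟩
  simpa using sub_memLp.add hg

lemma tendsto_Lp_iff_of_ae_eq [Fact (1 ≤ p)] {f : ι → Lp E p μ} {g : Lp E p μ}
    {f' : ι → α → E} {g' : α → E} (hf : ∀ i, f i =ᵐ[μ] f' i) (hg : g =ᵐ[μ] g') :
    Tendsto f l (𝓝 g) ↔ Tendsto (fun i => eLpNorm (fun x => f' i x - g' x) p μ) l (𝓝 0) := by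
  rw [Lp.tendsto_Lp_iff_tendsto_eLpNorm']
  exact tendsto_congr fun i => eLpNorm_congr_ae ((hf i).sub hg)

end Lp

section Weighted

variable {α E : Type*} [MeasurableSpace α] {μ : Measure α} [NormedAddCommGroup E]
  [InnerProductSpace ℝ E] {f : α → ℝ}

/-- Multiplication by an essentially bounded function on `L²`. -/
noncomputable def mulOp (f : α → ℝ) (hf : MemLp f ⊤ μ) : Lp E 2 μ →L[ℝ] Lp E 2 μ :=
  (ContinuousLinearMap.lsmul ℝ ℝ : ℝ →L[ℝ] E →L[ℝ] E).holderL μ ⊤ 2 2 (hf.toLp f)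

lemma coeFn_mulOp (hf : MemLp f ⊤ μ) (u : Lp E 2 μ) : mulOp f hf u =ᵐ[μ] fun x => f x • u x := by
  filter_upwards [(ContinuousLinearMap.lsmul ℝ ℝ : ℝ →L[ℝ] E →L[ℝ] E).coeFn_holder (r := 2)
    (hf.toLp f) u, hf.coeFn_toLp] with x holder toLp
  exact holder.trans (by simp [toLp])

/-- The `L²` inner product weighted by an essentially bounded function. -/
noncomputable def weightedInner (f : α → ℝ) (hf : MemLp f ⊤ μ) :
    Lp E 2 μ →L[ℝ] Lp E 2 μ →L[ℝ] ℝ :=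
  (innerSL ℝ : Lp E 2 μ →L[ℝ] Lp E 2 μ →L[ℝ] ℝ).comp (mulOp f hf)

section Representatives

variable {u v : Lp E 2 μ} {u' v' : α → E}

lemma inner_mulOp_ae_eq (hf : MemLp f ⊤ μ) (hu : u =ᵐ[μ] u') (hv : v =ᵐ[μ] v') :
    (fun x => inner ℝ (mulOp f hf u x) (v x)) =ᵐ[μ] fun x => f x * inner ℝ (u' x) (v' x) := by
  filter_upwards [coeFn_mulOp hf u, hu, hv] with x hmul hux hvx
  rw [hmul, hux, hvx, real_inner_smul_left]

lemma integrable_weighted (hf : MemLp f ⊤ μ) (hu : u =ᵐ[μ] u') (hv : v =ᵐ[μ] v') :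
    Integrable (fun x => f x * inner ℝ (u' x) (v' x)) μ :=
  (L2.integrable_inner (𝕜 := ℝ) (mulOp f hf u) v).congr (inner_mulOp_ae_eq hf hu hv)

lemma weightedInner_eq_integral (hf : MemLp f ⊤ μ) (hu : u =ᵐ[μ] u') (hv : v =ᵐ[μ] v') :
    weightedInner f hf u v = ∫ x, f x * inner ℝ (u' x) (v' x) ∂μ :=
  (L2.inner_def (𝕜 := ℝ) (mulOp f hf u) v).trans
    (integral_congr_ae (inner_mulOp_ae_eq hf hu hv))

end Representatives

lemma weightedInner_indicator_eq_setIntegral {A : Set α} (hA : MeasurableSet A)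
    (hf : MemLp (A.indicator f) ⊤ μ) {u v : Lp ℝ 2 μ} {u' v' : α → ℝ} (hu : u =ᵐ[μ] u')
    (hv : v =ᵐ[μ] v') : weightedInner (A.indicator f) hf u v = ∫ x in A, f x * u' x * v' x ∂μ := by
  rw [weightedInner_eq_integral hf hu hv, ← integral_indicator hA]
  refine integral_congr_ae (.of_forall fun x => ?_)
  by_cases hx : x ∈ A
  · simp only [indicator_of_mem hx, RCLike.inner_apply, conj_trivial]
    ring
  · simp only [indicator_of_notMem hx, zero_mul]

lemma mul_norm_sq_le_weightedInner_self (hf : MemLp f ⊤ μ) {m : ℝ} (hm : ∀ᵐ x ∂μ, m ≤ f x)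
    (u : Lp E 2 μ) : m * ‖u‖ ^ 2 ≤ weightedInner f hf u u := by
  rw [weightedInner_eq_integral hf .rfl .rfl, ← real_inner_self_eq_norm_sq, L2.inner_def,
    ← integral_const_mul]
  refine integral_mono_ae ((L2.integrable_inner u u).const_mul m)
    (integrable_weighted hf .rfl .rfl) ?_
  filter_upwards [hm] with x hx
  exact mul_le_mul_of_nonneg_right hx real_inner_self_nonneg

lemma weightedInner_self_nonneg (hf : MemLp f ⊤ μ) {u : Lp E 2 μ}
    (h : ∀ᵐ x ∂μ, u x = 0 ∨ 0 ≤ f x) : 0 ≤ weightedInner f hf u u := by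
  rw [weightedInner_eq_integral hf .rfl .rfl]
  refine integral_nonneg_of_ae ?_
  filter_upwards [h] with x hx
  rcases hx with hx | hx
  · simp [hx]
  · exact mul_nonneg hx real_inner_self_nonneg

lemma ofReal_weightedInner_self (hf : MemLp f ⊤ μ) (h : ∀ᵐ x ∂μ, 0 ≤ f x) {u : Lp E 2 μ}
    {u' : α → E} (hu : u =ᵐ[μ] u') : ENNReal.ofReal (weightedInner f hf u u) =
      ∫⁻ x, ‖u' x‖ₑ ^ 2 ∂μ.withDensity fun x => ENNReal.ofReal (f x) := by
  have u'_meas : AEStronglyMeasurable u' μ := (Lp.aestronglyMeasurable u).congr hu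
  rw [weightedInner_eq_integral hf hu hu,
    ofReal_integral_eq_lintegral_ofReal (integrable_weighted hf hu hu),
    lintegral_withDensity_eq_lintegral_mul₀ hf.1.aemeasurable.ennreal_ofReal
      (u'_meas.enorm.pow_const 2)]
  · refine lintegral_congr_ae ?_
    filter_upwards [h] with x hx
    rw [ENNReal.ofReal_mul hx, real_inner_self_eq_norm_sq, ENNReal.ofReal_pow (norm_nonneg _),
      ofReal_norm, Pi.mul_apply]
  · filter_upwards [h] with x hx
    exact mul_nonneg hx real_inner_self_nonneg

lemma continuous_weightedInner {V : Type*} [NormedAddCommGroup V] [NormedSpace ℝ V]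
    (hf : MemLp f ⊤ μ) (P Q : V →L[ℝ] Lp E 2 μ) :
    Continuous fun X => weightedInner f hf (P X) (Q X) :=
  ((weightedInner f hf).continuous.comp P.continuous).clm_apply Q.continuous

end Weighted

section WeakDeriv

variable {U : Set Space} {e : Space}

lemma contDiff_one_of_contDiff_infty {E F : Type*} [NormedAddCommGroup E] [NormedSpace ℝ E]
    [NormedAddCommGroup F] [NormedSpace ℝ F] {ψ : E → F} (hψ : ContDiff ℝ ∞ ψ) : ContDiff ℝ 1 ψ :=
  hψ.of_le (by norm_cast)

lemma IsWeakDeriv.congr {u u' v v' : Space → ℝ} (h : IsWeakDeriv U u v e)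
    (hu : u =ᵐ[volume.restrict U] u') (hv : v =ᵐ[volume.restrict U] v') :
    IsWeakDeriv U u' v' e := by
  intro φ hφ hc hsub
  calc ∫ y in U, u' y * fderiv ℝ φ y e = ∫ y in U, u y * fderiv ℝ φ y e :=
        (integral_congr_ae (hu.mul EventuallyEq.rfl)).symm
    _ = -∫ y in U, v y * φ y := h φ hφ hc hsub
    _ = -∫ y in U, v' y * φ y := congrArg Neg.neg (integral_congr_ae (hv.mul EventuallyEq.rfl))

instance : (volume : Measure Space).IsAddHaarMeasure :=
  inferInstanceAs ((volume : Measure Plane).prod (volume : Measure ℝ)).IsAddHaarMeasure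

lemma isWeakDeriv_of_contDiff {ψ : Space → ℝ} (hψ : ContDiff ℝ 1 ψ) (U : Set Space) (e : Space) :
    IsWeakDeriv U ψ (fun y => fderiv ℝ ψ y e) e := by
  intro φ hφ hc hsub
  have hφ1 := contDiff_one_of_contDiff_infty hφ
  have continuous_fderiv {f : Space → ℝ} (hf : ContDiff ℝ 1 f) : Continuous (fderiv ℝ f · e) :=
    (hf.continuous_fderiv one_ne_zero).clm_apply continuous_const
  rw [setIntegral_eq_integral_of_forall_compl_eq_zero,
    setIntegral_eq_integral_of_forall_compl_eq_zero]
  · exact integral_mul_fderiv_eq_neg_fderiv_mul_of_integrable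
      (((continuous_fderiv hψ).mul hφ.continuous).integrable_of_hasCompactSupport hc.mul_left)
      ((hψ.continuous.mul (continuous_fderiv hφ1)).integrable_of_hasCompactSupport
        (hc.fderiv_apply ℝ e).mul_left)
      ((hψ.continuous.mul hφ.continuous).integrable_of_hasCompactSupport hc.mul_left)
      (fun x _ => hψ.differentiable one_ne_zero x) fun x _ => hφ1.differentiable one_ne_zero x
  · intro y hy
    rw [image_eq_zero_of_notMem_tsupport fun h => hy (hsub h), mul_zero]
  · intro y hy
    have fderiv_eq_zero : fderiv ℝ φ y = 0 := by
      by_contra h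
      exact hy (hsub (support_fderiv_subset ℝ h))
    simp [fderiv_eq_zero]

lemma isClosed_setOf_isWeakDeriv (U : Set Space) (e : Space) :
    IsClosed {p : Lp ℝ 2 (volume.restrict U) × Lp ℝ 2 (volume.restrict U) |
      IsWeakDeriv U p.1 p.2 e} := by
  simp only [IsWeakDeriv, ofPred_forall]
  refine isClosed_iInter fun φ => isClosed_iInter fun hφ => isClosed_iInter fun hc =>
    isClosed_iInter fun _ => ?_
  have integral_eq_inner {f : Space → ℝ} (hf : MemLp f 2 (volume.restrict U))
      (u : Lp ℝ 2 (volume.restrict U)) : ∫ y in U, u y * f y = inner ℝ u (hf.toLp f) := by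
    rw [L2.inner_def]
    refine integral_congr_ae ?_
    filter_upwards [hf.coeFn_toLp] with y hy
    simp [hy, mul_comm]
  have continuous_fderiv : Continuous (fderiv ℝ φ · e) :=
    ((contDiff_one_of_contDiff_infty hφ).continuous_fderiv one_ne_zero).clm_apply continuous_const
  have memLp_fderiv : MemLp (fderiv ℝ φ · e) 2 (volume.restrict U) :=
    (continuous_fderiv.memLp_of_hasCompactSupport (hc.fderiv_apply ℝ e)).restrict U
  have memLp_φ : MemLp φ 2 (volume.restrict U) :=
    (hφ.continuous.memLp_of_hasCompactSupport hc).restrict U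
  simp only [integral_eq_inner memLp_fderiv, integral_eq_inner memLp_φ]
  exact isClosed_eq (continuous_fst.inner continuous_const)
    (continuous_snd.inner continuous_const).neg

end WeakDeriv

/-- The Hilbert space of quadruples `(u, v, w, g)` of a function, a cross-sectional vector field and
a function on the cylinder, and a function on its boundary, all square integrable. A function of
`H¹` sits in it as the function, its two derivatives and its trace. -/
def DataSpace (Ω : Set Plane) (z₁ z₂ : ℝ) : Type :=
  WithLp 2 (Lp ℝ 2 (volume.restrict (cylinder Ω z₁ z₂)) ×
    WithLp 2 (Lp Plane 2 (volume.restrict (cylinder Ω z₁ z₂)) ×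
      WithLp 2 (Lp ℝ 2 (volume.restrict (cylinder Ω z₁ z₂)) × Lp ℝ 2 (boundaryMeasure Ω z₁ z₂))))

namespace DataSpace

variable {Ω : Set Plane} {z₁ z₂ : ℝ}

noncomputable instance : NormedAddCommGroup (DataSpace Ω z₁ z₂) :=
  inferInstanceAs (NormedAddCommGroup (WithLp 2 (_ × WithLp 2 (_ × WithLp 2 (_ × _)))))

noncomputable instance : InnerProductSpace ℝ (DataSpace Ω z₁ z₂) :=
  inferInstanceAs (InnerProductSpace ℝ (WithLp 2 (_ × WithLp 2 (_ × WithLp 2 (_ × _)))))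

instance : CompleteSpace (DataSpace Ω z₁ z₂) :=
  inferInstanceAs (CompleteSpace (WithLp 2 (_ × WithLp 2 (_ × WithLp 2 (_ × _)))))

/-- The function component. -/
noncomputable def valL : DataSpace Ω z₁ z₂ →L[ℝ] Lp ℝ 2 (volume.restrict (cylinder Ω z₁ z₂)) :=
  WithLp.fstL 2 ℝ _ _

/-- The cross-sectional gradient component. -/
noncomputable def gradL :
    DataSpace Ω z₁ z₂ →L[ℝ] Lp Plane 2 (volume.restrict (cylinder Ω z₁ z₂)) :=
  (WithLp.fstL 2 ℝ _ _).comp (WithLp.sndL 2 ℝ _ _)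

/-- The axial derivative component. -/
noncomputable def dzL : DataSpace Ω z₁ z₂ →L[ℝ] Lp ℝ 2 (volume.restrict (cylinder Ω z₁ z₂)) :=
  (WithLp.fstL 2 ℝ _ _).comp ((WithLp.sndL 2 ℝ _ _).comp (WithLp.sndL 2 ℝ _ _))

/-- The boundary value component. -/
noncomputable def traceL : DataSpace Ω z₁ z₂ →L[ℝ] Lp ℝ 2 (boundaryMeasure Ω z₁ z₂) :=
  (WithLp.sndL 2 ℝ _ _).comp ((WithLp.sndL 2 ℝ _ _).comp (WithLp.sndL 2 ℝ _ _))

/-- The quadruple with given components. -/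
noncomputable def mk (u : Lp ℝ 2 (volume.restrict (cylinder Ω z₁ z₂)))
    (v : Lp Plane 2 (volume.restrict (cylinder Ω z₁ z₂)))
    (w : Lp ℝ 2 (volume.restrict (cylinder Ω z₁ z₂))) (g : Lp ℝ 2 (boundaryMeasure Ω z₁ z₂)) :
    DataSpace Ω z₁ z₂ :=
  WithLp.toLp 2 (u, WithLp.toLp 2 (v, WithLp.toLp 2 (w, g)))

lemma norm_sq_eq (X : DataSpace Ω z₁ z₂) :
    ‖X‖ ^ 2 = ‖valL X‖ ^ 2 + ‖gradL X‖ ^ 2 + ‖dzL X‖ ^ 2 + ‖traceL X‖ ^ 2 := by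
  refine (WithLp.prod_norm_sq_eq_of_L2 _).trans ?_
  rw [WithLp.prod_norm_sq_eq_of_L2, WithLp.prod_norm_sq_eq_of_L2, ← add_assoc, ← add_assoc]
  rfl

lemma tendsto_of_components {ι : Type*} {l : Filter ι} {X : ι → DataSpace Ω z₁ z₂}
    {Y : DataSpace Ω z₁ z₂} (hval : Tendsto (fun i => valL (X i)) l (𝓝 (valL Y)))
    (hgrad : Tendsto (fun i => gradL (X i)) l (𝓝 (gradL Y)))
    (hdz : Tendsto (fun i => dzL (X i)) l (𝓝 (dzL Y)))
    (htrace : Tendsto (fun i => traceL (X i)) l (𝓝 (traceL Y))) : Tendsto X l (𝓝 Y) := by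
  have dz_trace := ((WithLp.prod_continuous_toLp 2 _ _).tendsto _).comp (hdz.prodMk_nhds htrace)
  have grad_dz_trace :=
    ((WithLp.prod_continuous_toLp 2 _ _).tendsto _).comp (hgrad.prodMk_nhds dz_trace)
  exact ((WithLp.prod_continuous_toLp 2 _ _).tendsto _).comp (hval.prodMk_nhds grad_dz_trace)

/-- The given functions are representatives of the components of `X`. -/
structure Represents (X : DataSpace Ω z₁ z₂) (u : Space → ℝ) (v : Space → Plane) (w g : Space → ℝ) :
    Prop where
  val : valL X =ᵐ[volume.restrict (cylinder Ω z₁ z₂)] u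
  grad : gradL X =ᵐ[volume.restrict (cylinder Ω z₁ z₂)] v
  dz : dzL X =ᵐ[volume.restrict (cylinder Ω z₁ z₂)] w
  trace : traceL X =ᵐ[boundaryMeasure Ω z₁ z₂] g

lemma represents_self (X : DataSpace Ω z₁ z₂) :
    Represents X (valL X) (gradL X) (dzL X) (traceL X) :=
  ⟨.rfl, .rfl, .rfl, .rfl⟩

variable {u u' w w' g g' : Space → ℝ} {v v' : Space → Plane} {X X' : DataSpace Ω z₁ z₂}

lemma represents_mk (hu : MemLp u 2 (volume.restrict (cylinder Ω z₁ z₂)))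
    (hv : MemLp v 2 (volume.restrict (cylinder Ω z₁ z₂)))
    (hw : MemLp w 2 (volume.restrict (cylinder Ω z₁ z₂)))
    (hg : MemLp g 2 (boundaryMeasure Ω z₁ z₂)) :
    Represents (mk (hu.toLp u) (hv.toLp v) (hw.toLp w) (hg.toLp g)) u v w g :=
  ⟨hu.coeFn_toLp, hv.coeFn_toLp, hw.coeFn_toLp, hg.coeFn_toLp⟩

lemma Represents.add (h : Represents X u v w g) (h' : Represents X' u' v' w' g') :
    Represents (X + X') (u + u') (v + v') (w + w') (g + g') where
  val := by rw [map_add]; exact (Lp.coeFn_add _ _).trans (h.val.add h'.val)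
  grad := by rw [map_add]; exact (Lp.coeFn_add _ _).trans (h.grad.add h'.grad)
  dz := by rw [map_add]; exact (Lp.coeFn_add _ _).trans (h.dz.add h'.dz)
  trace := by rw [map_add]; exact (Lp.coeFn_add _ _).trans (h.trace.add h'.trace)

lemma Represents.smul (h : Represents X u v w g) (c : ℝ) :
    Represents (c • X) (c • u) (c • v) (c • w) (c • g) where
  val := by rw [map_smul]; exact (Lp.coeFn_smul _ _).trans (h.val.const_smul c)
  grad := by rw [map_smul]; exact (Lp.coeFn_smul _ _).trans (h.grad.const_smul c)
  dz := by rw [map_smul]; exact (Lp.coeFn_smul _ _).trans (h.dz.const_smul c)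
  trace := by rw [map_smul]; exact (Lp.coeFn_smul _ _).trans (h.trace.const_smul c)

end DataSpace

open DataSpace

section TraceData

variable {Ω : Set Plane} {z₁ z₂ : ℝ}

variable (Ω z₁ z₂) in
/-- The quadruples coming from functions smooth up to the boundary. -/
def smoothData : Submodule ℝ (DataSpace Ω z₁ z₂) where
  carrier := {X | ∃ ψ : Space → ℝ, ContDiff ℝ ∞ ψ ∧
    Represents X ψ (sliceGrad ψ) (sliceDeriv ψ) ψ}
  add_mem' := by
    rintro X Y ⟨ψ, hψ, hX⟩ ⟨φ, hφ, hY⟩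
    have hψ1 := contDiff_one_of_contDiff_infty hψ
    have hφ1 := contDiff_one_of_contDiff_infty hφ
    refine ⟨ψ + φ, hψ.add hφ, ?_⟩
    rw [sliceGrad_add hψ1 hφ1, sliceDeriv_add hψ1 hφ1]
    exact hX.add hY
  zero_mem' := by
    have sliceGrad_zero : sliceGrad (0 : Space → ℝ) = 0 := by
      simpa using sliceGrad_smul (ψ := (0 : Space → ℝ)) contDiff_const 0
    have sliceDeriv_zero : sliceDeriv (0 : Space → ℝ) = 0 := by
      simpa using sliceDeriv_smul (ψ := (0 : Space → ℝ)) contDiff_const 0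
    refine ⟨0, contDiff_const, ?_⟩
    rw [sliceGrad_zero, sliceDeriv_zero]
    simpa using (represents_self (0 : DataSpace Ω z₁ z₂)).smul 0
  smul_mem' := by
    rintro c X ⟨ψ, hψ, hX⟩
    have hψ1 := contDiff_one_of_contDiff_infty hψ
    refine ⟨c • ψ, hψ.const_smul c, ?_⟩
    rw [sliceGrad_smul hψ1, sliceDeriv_smul hψ1]
    exact hX.smul c

variable (Ω z₁ z₂) in
/-- The quadruples that consist of an `H¹` function, its derivatives and its trace. As in
`HasTrace`, they are the limits of quadruples of smooth functions. -/
noncomputable def traceData : Submodule ℝ (DataSpace Ω z₁ z₂) :=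
  (smoothData Ω z₁ z₂).topologicalClosure

lemma isClosed_traceData : IsClosed (traceData Ω z₁ z₂ : Set (DataSpace Ω z₁ z₂)) :=
  Submodule.isClosed_topologicalClosure _

lemma traceData_induction {p : DataSpace Ω z₁ z₂ → Prop} (hp : IsClosed {X | p X})
    (h : ∀ (X : DataSpace Ω z₁ z₂) (ψ : Space → ℝ), ContDiff ℝ ∞ ψ →
      Represents X ψ (sliceGrad ψ) (sliceDeriv ψ) ψ → p X)
    {X : DataSpace Ω z₁ z₂} (hX : X ∈ traceData Ω z₁ z₂) : p X :=
  closure_minimal (fun Y (hY : Y ∈ smoothData Ω z₁ z₂) => hY.elim fun ψ hψ => h Y ψ hψ.1 hψ.2) hp hX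

variable {T : H1 Ω z₁ z₂} {g : Space → ℝ} {X : DataSpace Ω z₁ z₂}

lemma HasTrace.mem_traceData (h : HasTrace T g) (hX : Represents X T.val T.grad T.dz g) :
    X ∈ traceData Ω z₁ z₂ := by
  obtain ⟨ψ, hψ, tendsto_val, tendsto_grad, tendsto_dz, tendsto_trace⟩ := h.approx
  have hψ1 (n : ℕ) := contDiff_one_of_contDiff_infty (hψ n)
  have eventually_memLp := (eventually_memLp_of_tendsto
      (fun n => (hψ n).continuous.aestronglyMeasurable) T.memLp_val tendsto_val).and <|
    (eventually_memLp_of_tendsto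
      (fun n => (continuous_sliceGrad (hψ1 n)).aestronglyMeasurable) T.memLp_grad
        tendsto_grad).and <|
    (eventually_memLp_of_tendsto
      (fun n => (continuous_sliceDeriv (hψ1 n)).aestronglyMeasurable) T.memLp_dz tendsto_dz).and <|
    eventually_memLp_of_tendsto
      (fun n => (hψ n).continuous.aestronglyMeasurable) h.memLp tendsto_trace
  obtain ⟨N, hN⟩ := eventually_atTop.1 eventually_memLp
  have exists_represents (n : ℕ) : ∃ Y : DataSpace Ω z₁ z₂,
      Represents Y (ψ (n + N)) (sliceGrad (ψ (n + N))) (sliceDeriv (ψ (n + N))) (ψ (n + N)) := by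
    obtain ⟨memLp_val, memLp_grad, memLp_dz, memLp_trace⟩ := hN (n + N) (Nat.le_add_left N n)
    exact ⟨_, represents_mk memLp_val memLp_grad memLp_dz memLp_trace⟩
  choose Y hY using exists_represents
  refine mem_closure_of_tendsto (f := Y) (b := atTop) (tendsto_of_components ?_ ?_ ?_ ?_)
    (Eventually.of_forall fun n => ⟨ψ (n + N), hψ _, hY n⟩)
  · exact (tendsto_Lp_iff_of_ae_eq (fun n => (hY n).val) hX.val).2
      ((tendsto_add_atTop_iff_nat N).2 tendsto_val)
  · exact (tendsto_Lp_iff_of_ae_eq (fun n => (hY n).grad) hX.grad).2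
      ((tendsto_add_atTop_iff_nat N).2 tendsto_grad)
  · exact (tendsto_Lp_iff_of_ae_eq (fun n => (hY n).dz) hX.dz).2
      ((tendsto_add_atTop_iff_nat N).2 tendsto_dz)
  · exact (tendsto_Lp_iff_of_ae_eq (fun n => (hY n).trace) hX.trace).2
      ((tendsto_add_atTop_iff_nat N).2 tendsto_trace)

lemma hasTrace_of_mem_traceData (hX : Represents X T.val T.grad T.dz g)
    (h : X ∈ traceData Ω z₁ z₂) : HasTrace T g := by
  obtain ⟨Y, hY, hlim⟩ := mem_closure_iff_seq_limit.1 h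
  choose ψ hψ hψY using hY
  have tendsto_component {V : Type} [TopologicalSpace V] [AddCommMonoid V] [Module ℝ V]
      (P : DataSpace Ω z₁ z₂ →L[ℝ] V) : Tendsto (fun n => P (Y n)) atTop (𝓝 (P X)) :=
    (P.continuous.tendsto X).comp hlim
  refine ⟨(Lp.memLp (traceL X)).ae_eq hX.trace, ψ, hψ, ?_, ?_, ?_, ?_⟩
  · exact (tendsto_Lp_iff_of_ae_eq (fun n => (hψY n).val) hX.val).1 (tendsto_component valL)
  · exact (tendsto_Lp_iff_of_ae_eq (fun n => (hψY n).grad) hX.grad).1 (tendsto_component gradL)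
  · exact (tendsto_Lp_iff_of_ae_eq (fun n => (hψY n).dz) hX.dz).1 (tendsto_component dzL)
  · exact (tendsto_Lp_iff_of_ae_eq (fun n => (hψY n).trace) hX.trace).1 (tendsto_component traceL)

lemma isWeakDeriv_gradL (hX : X ∈ traceData Ω z₁ z₂) (e : Plane) :
    IsWeakDeriv (cylinder Ω z₁ z₂) (valL X) (fun y => inner ℝ (gradL X y) e) (e, 0) := by
  have inner_ae_eq (Y : DataSpace Ω z₁ z₂) :
      (innerSL ℝ e).compLp (gradL Y) =ᵐ[volume.restrict (cylinder Ω z₁ z₂)]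
        fun y => inner ℝ (gradL Y y) e := by
    filter_upwards [(innerSL ℝ e).coeFn_compLp (gradL Y)] with y hy
    rw [hy, innerSL_apply_apply, real_inner_comm]
  refine IsWeakDeriv.congr (traceData_induction (p := fun Y => IsWeakDeriv (cylinder Ω z₁ z₂)
    (valL Y) ((innerSL ℝ e).compLp (gradL Y)) (e, 0)) ?_ ?_ hX) .rfl (inner_ae_eq X)
  · exact (isClosed_setOf_isWeakDeriv (cylinder Ω z₁ z₂) (e, 0)).preimage
      (valL.continuous.prodMk (((innerSL ℝ e).compLpL 2 _).continuous.comp gradL.continuous))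
  · intro Y ψ hψ hY
    have hψ1 := contDiff_one_of_contDiff_infty hψ
    refine (isWeakDeriv_of_contDiff hψ1 _ _).congr hY.val.symm ?_
    filter_upwards [hY.grad, inner_ae_eq Y] with y hgrad hinner
    rw [hinner, hgrad, inner_sliceGrad hψ1]

lemma isWeakDeriv_dzL (hX : X ∈ traceData Ω z₁ z₂) :
    IsWeakDeriv (cylinder Ω z₁ z₂) (valL X) (dzL X) (0, 1) := by
  refine traceData_induction (p := fun Y => IsWeakDeriv _ (valL Y) (dzL Y) (0, 1))
    ((isClosed_setOf_isWeakDeriv _ _).preimage (valL.continuous.prodMk dzL.continuous)) ?_ hX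
  intro Y ψ hψ hY
  have hψ1 := contDiff_one_of_contDiff_infty hψ
  refine (isWeakDeriv_of_contDiff hψ1 _ _).congr hY.val.symm ?_
  filter_upwards [hY.dz] with y hy
  rw [hy, sliceDeriv_apply hψ1]

/-- The `H¹` function underlying a quadruple. -/
noncomputable def H1.ofData (hX : X ∈ traceData Ω z₁ z₂) : H1 Ω z₁ z₂ where
  val := valL X
  grad := gradL X
  dz := dzL X
  memLp_val := Lp.memLp _
  memLp_grad := Lp.memLp _
  memLp_dz := Lp.memLp _
  weak_grad := isWeakDeriv_gradL hX
  weak_dz := isWeakDeriv_dzL hX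

lemma hasTrace_ofData (hX : X ∈ traceData Ω z₁ z₂) : HasTrace (H1.ofData hX) (traceL X) :=
  hasTrace_of_mem_traceData (represents_self X) hX

lemma HasTrace.exists_data (h : HasTrace T g) :
    ∃ X ∈ traceData Ω z₁ z₂, Represents X T.val T.grad T.dz g :=
  have hX := represents_mk T.memLp_val T.memLp_grad T.memLp_dz h.memLp
  ⟨_, h.mem_traceData hX, hX⟩

end TraceData

section Essential

variable {Ω : Set Plane} {z₁ z₂ : ℝ} {Γ : LateralPartition Ω}

lemma LateralPartition.ΓR_subset (Γ : LateralPartition Ω) : Γ.ΓR ⊆ frontier Ω :=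
  Γ.cover ▸ fun _ hx => .inl (.inr hx)

lemma LateralPartition.Γper_subset (Γ : LateralPartition Ω) : Γ.Γper ⊆ frontier Ω :=
  Γ.cover ▸ subset_union_right

lemma LateralPartition.side_subset (Γ : LateralPartition Ω) (j : Fin Γ.numPairs) :
    Γ.side j ⊆ frontier Ω :=
  Subset.trans (Γ.Γper_eq ▸ subset_iUnion_of_subset j subset_union_left) Γ.Γper_subset

lemma LateralPartition.shift_side_subset (Γ : LateralPartition Ω) (j : Fin Γ.numPairs) :
    (fun x => x + Γ.shift j) '' Γ.side j ⊆ frontier Ω :=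
  Subset.trans (Γ.Γper_eq ▸ subset_iUnion_of_subset j subset_union_right) Γ.Γper_subset

/-- The essential conditions on a trace `g`: the lateral ones, and `g = TD` on `ΩD`. -/
def EssentialConditions (Γ : LateralPartition Ω) (z₁ z₂ : ℝ) (ΩD : Set Space)
    (TD g : Space → ℝ) : Prop :=
  LateralEssential Γ z₁ z₂ g ∧ ∀ᵐ y ∂(boundaryMeasure Ω z₁ z₂).restrict ΩD, g y = TD y

variable {ΩD : Set Space} {TD TD' g g' : Space → ℝ}

namespace EssentialConditions

lemma zero (Γ : LateralPartition Ω) (z₁ z₂ : ℝ) (ΩD : Set Space) :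
    EssentialConditions Γ z₁ z₂ ΩD 0 0 :=
  ⟨⟨.of_forall fun _ => rfl, fun _ => .of_forall fun _ => rfl⟩, .of_forall fun _ => rfl⟩

lemma add (h : EssentialConditions Γ z₁ z₂ ΩD TD g) (h' : EssentialConditions Γ z₁ z₂ ΩD TD' g') :
    EssentialConditions Γ z₁ z₂ ΩD (TD + TD') (g + g') := by
  refine ⟨⟨?_, fun j => ?_⟩, ?_⟩
  · filter_upwards [h.1.1, h'.1.1] with y hy hy'
    simp [hy, hy']
  · filter_upwards [h.1.2 j, h'.1.2 j] with y hy hy'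
    simp [hy, hy']
  · filter_upwards [h.2, h'.2] with y hy hy'
    simp [hy, hy']

lemma smul (h : EssentialConditions Γ z₁ z₂ ΩD TD g) (c : ℝ) :
    EssentialConditions Γ z₁ z₂ ΩD (c • TD) (c • g) := by
  refine ⟨⟨?_, fun j => ?_⟩, ?_⟩
  · filter_upwards [h.1.1] with y hy
    simp [hy]
  · filter_upwards [h.1.2 j] with y hy
    simp [hy]
  · filter_upwards [h.2] with y hy
    simp [hy]

end EssentialConditions

variable [SFinite ((Measure.hausdorffMeasure 1 : Measure Plane).restrict (frontier Ω))]

lemma ae_shift {p : Space → Prop} (h : ∀ᵐ y ∂boundaryMeasure Ω z₁ z₂, p y)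
    (j : Fin Γ.numPairs) :
    ∀ᵐ y ∂(boundaryMeasure Ω z₁ z₂).restrict (Γ.side j ×ˢ Ioo z₁ z₂), p (y.1 + Γ.shift j, y.2) :=
  (quasiMeasurePreserving_add_const (Γ.side_subset j) (Γ.shift_side_subset j)).ae h

namespace EssentialConditions

lemma congr (h : EssentialConditions Γ z₁ z₂ ΩD TD g) (hg : g =ᵐ[boundaryMeasure Ω z₁ z₂] g') :
    EssentialConditions Γ z₁ z₂ ΩD TD g' := by
  refine ⟨⟨?_, fun j => ?_⟩, ?_⟩
  · filter_upwards [h.1.1, ae_restrict_of_ae hg] with y hy eq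
    rw [← eq, hy]
  · filter_upwards [h.1.2 j, ae_restrict_of_ae hg, ae_shift hg j] with y hy eq eq_shift
    rw [← eq, ← eq_shift, hy]
  · filter_upwards [h.2, ae_restrict_of_ae hg] with y hy eq
    rw [← eq, hy]

lemma of_tendsto {g : ℕ → Space → ℝ} (h : ∀ n, EssentialConditions Γ z₁ z₂ ΩD TD (g n))
    (hlim : ∀ᵐ y ∂boundaryMeasure Ω z₁ z₂, Tendsto (fun n => g n y) atTop (𝓝 (g' y))) :
    EssentialConditions Γ z₁ z₂ ΩD TD g' := by
  refine ⟨⟨?_, fun j => ?_⟩, ?_⟩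
  · filter_upwards [ae_all_iff.2 fun n => (h n).1.1, ae_restrict_of_ae hlim] with y hy lim
    simp only [hy] at lim
    exact tendsto_nhds_unique lim tendsto_const_nhds
  · filter_upwards [ae_all_iff.2 fun n => (h n).1.2 j, ae_restrict_of_ae hlim,
      ae_shift hlim j] with y hy lim lim_shift
    simp only [hy] at lim_shift
    exact tendsto_nhds_unique lim_shift lim
  · filter_upwards [ae_all_iff.2 fun n => (h n).2, ae_restrict_of_ae hlim] with y hy lim
    simp only [hy] at lim
    exact tendsto_nhds_unique lim tendsto_const_nhds

end EssentialConditions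

variable (z₁ z₂ Γ ΩD) in
/-- The quadruples of test functions: those of `H¹` functions satisfying the homogeneous essential
conditions. -/
noncomputable def testData : Submodule ℝ (DataSpace Ω z₁ z₂) where
  carrier := {X | X ∈ traceData Ω z₁ z₂ ∧ EssentialConditions Γ z₁ z₂ ΩD 0 (traceL X)}
  add_mem' := by
    rintro X Y ⟨hX, hX_ess⟩ ⟨hY, hY_ess⟩
    refine ⟨add_mem hX hY, ?_⟩
    simpa using (hX_ess.add hY_ess).congr ((represents_self X).add (represents_self Y)).trace.symm
  zero_mem' := by
    refine ⟨zero_mem _, ?_⟩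
    rw [map_zero]
    exact (EssentialConditions.zero Γ z₁ z₂ ΩD).congr (Lp.coeFn_zero _ _ _).symm
  smul_mem' := by
    rintro c X ⟨hX, hX_ess⟩
    refine ⟨Submodule.smul_mem _ c hX, ?_⟩
    simpa using (hX_ess.smul c).congr ((represents_self X).smul c).trace.symm

lemma isClosed_testData : IsClosed (testData z₁ z₂ Γ ΩD : Set (DataSpace Ω z₁ z₂)) := by
  refine IsSeqClosed.isClosed fun X Y hX hlim => ?_
  obtain ⟨n, -, hn⟩ := (tendstoInMeasure_of_tendsto_Lp
    ((traceL.continuous.tendsto Y).comp hlim)).exists_seq_tendsto_ae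
  exact ⟨isClosed_traceData.mem_of_tendsto hlim (.of_forall fun k => (hX k).1),
    .of_tendsto (fun k => (hX (n k)).2) hn⟩

lemma sub_mem_testData_iff {X X₀ : DataSpace Ω z₁ z₂} (hX₀ : X₀ ∈ traceData Ω z₁ z₂)
    (hX₀_ess : EssentialConditions Γ z₁ z₂ ΩD TD (traceL X₀)) :
    X - X₀ ∈ testData z₁ z₂ Γ ΩD ↔
      X ∈ traceData Ω z₁ z₂ ∧ EssentialConditions Γ z₁ z₂ ΩD TD (traceL X) := by
  constructor
  · rintro ⟨hsub, hsub_ess⟩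
    have hsum := ((represents_self (X - X₀)).add (represents_self X₀)).trace
    rw [sub_add_cancel] at hsum
    have hsum_ess := hsub_ess.add hX₀_ess
    rw [zero_add] at hsum_ess
    exact ⟨sub_add_cancel X X₀ ▸ add_mem hsub hX₀, hsum_ess.congr hsum.symm⟩
  · rintro ⟨hX, hX_ess⟩
    have hdiff := ((represents_self X).add ((represents_self X₀).smul (-1))).trace
    have hdiff_ess := hX_ess.add (hX₀_ess.smul (-1))
    rw [neg_one_smul, ← sub_eq_add_neg] at hdiff
    rw [neg_one_smul, add_neg_cancel] at hdiff_ess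
    exact ⟨sub_mem hX hX₀, hdiff_ess.congr hdiff.symm⟩

end Essential

section Convection

variable {Ω : Set Plane} {z₁ z₂ : ℝ} {h : Plane → ℝ}

lemma integral_deriv_mul_self {f : ℝ → ℝ} (hf : ContDiff ℝ 1 f) {a b : ℝ} (hab : a ≤ b) :
    ∫ t in Ioo a b, deriv f t * f t = (f b ^ 2 - f a ^ 2) / 2 := by
  have hasDerivAt_half_sq (t : ℝ) : HasDerivAt (fun t => f t ^ 2 / 2) (deriv f t * f t) t :=
    (((hf.differentiable one_ne_zero t).hasDerivAt.fun_pow 2).div_const 2).congr_deriv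
      (by norm_num; ring)
  rw [← integral_Ioc_eq_integral_Ioo, ← intervalIntegral.integral_of_le hab,
    intervalIntegral.integral_eq_sub_of_hasDerivAt (fun t _ => hasDerivAt_half_sq t)
      (((hf.continuous_deriv le_rfl).mul hf.continuous).intervalIntegrable _ _)]
  ring

variable [SFinite ((Measure.hausdorffMeasure 1 : Measure Plane).restrict (frontier Ω))]

theorem weightedInner_dzL_valL (hΩ : IsOpen Ω) (hz : z₁ < z₂)
    (hh : MemLp h ⊤ (volume.restrict Ω)) {X : DataSpace Ω z₁ z₂} (hX : X ∈ traceData Ω z₁ z₂) :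
    weightedInner _ (memLp_top_cylinder hh) (dzL X) (valL X)
      = weightedInner _ (memLp_top_axialFlux hΩ hz hh) (traceL X) (traceL X) / 2 := by
  refine traceData_induction (p := fun X => weightedInner _ (memLp_top_cylinder hh) (dzL X) (valL X)
    = weightedInner _ (memLp_top_axialFlux hΩ hz hh) (traceL X) (traceL X) / 2) ?_ ?_ hX
  · exact isClosed_eq (continuous_weightedInner _ dzL valL)
      ((continuous_weightedInner _ traceL traceL).div_const 2)
  intro Y ψ hψ hY
  have hψ1 := contDiff_one_of_contDiff_infty hψ
  have integrable_cyl := integrable_weighted (memLp_top_cylinder hh) hY.dz hY.val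
  rw [weightedInner_eq_integral _ hY.dz hY.val, weightedInner_eq_integral _ hY.trace hY.trace,
    integral_axialFlux_mul hΩ hz
      (integrable_weighted (memLp_top_axialFlux hΩ hz hh) hY.trace hY.trace), ← integral_div]
  rw [volume_restrict_cylinder] at integrable_cyl ⊢
  rw [integral_prod _ integrable_cyl]
  refine integral_congr_ae (.of_forall fun x => ?_)
  have slice_eq := integral_deriv_mul_self (f := fun z => ψ (x, z)) (by fun_prop) hz.le
  simp only [sliceDeriv, RCLike.inner_apply, conj_trivial, mul_comm (ψ _) (deriv _ _)]
  rw [integral_const_mul, slice_eq]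
  ring

theorem convection_nonneg {Γ : LateralPartition Ω} (hΩ : IsOpen Ω) (hz : z₁ < z₂)
    (hh : MemLp h ⊤ (volume.restrict Ω)) {ΩD : Set Space} (hΩD : MeasurableSet ΩD)
    (hin₁ : ∀ᵐ x ∂volume.restrict Ω, 0 < h x → (x, z₁) ∈ ΩD)
    (hin₂ : ∀ᵐ x ∂volume.restrict Ω, h x < 0 → (x, z₂) ∈ ΩD)
    {X : DataSpace Ω z₁ z₂} (hX : X ∈ testData z₁ z₂ Γ ΩD) :
    0 ≤ weightedInner _ (memLp_top_cylinder hh) (dzL X) (valL X) := by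
  rw [weightedInner_dzL_valL hΩ hz hh hX.1]
  refine div_nonneg (weightedInner_self_nonneg _ ?_) zero_le_two
  have vanishing := (ae_restrict_iff' hΩD).1 hX.2.2
  have at_inlet := ae_section hΩ hz (.inl rfl) (p := fun y => 0 < h y.1 → y ∈ ΩD) hin₁
  have at_outlet := ae_section hΩ hz (.inr rfl) (p := fun y => h y.1 < 0 → y ∈ ΩD) hin₂
  filter_upwards [vanishing, at_inlet, at_outlet] with ⟨x, z⟩ hD hin hout
  by_cases hmem : (x, z) ∈ ΩD
  · exact .inl (hD hmem)
  refine .inr ?_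
  rw [axialFlux, Pi.sub_apply, sub_nonneg]
  refine (indicator_apply_nonpos fun hx => ?_).trans (indicator_apply_nonneg fun hx => ?_)
  · exact not_lt.1 fun hpos => hmem (hin hx hpos)
  · exact not_lt.1 fun hneg => hmem (hout hx hneg)

end Convection

section WithDensity

variable {α : Type*} [MeasurableSpace α] {μ : Measure α} {b : α → ℝ}

lemma withDensity_ofReal_le_smul (hb : MemLp b ⊤ μ) :
    μ.withDensity (fun x => ENNReal.ofReal (b x)) ≤ (eLpNorm b ⊤ μ).toNNReal • μ := by
  rw [← Measure.coe_nnreal_smul, ENNReal.coe_toNNReal hb.2.ne, ← withDensity_const]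
  refine withDensity_mono ?_
  rw [eLpNorm_exponent_top]
  filter_upwards [ae_le_eLpNormEssSup (f := b) (μ := μ)] with x hx
  exact (Real.ofReal_le_enorm _).trans hx

lemma withDensity_ofReal_ne_zero (hb : AEMeasurable b μ) (h : ¬∀ᵐ x ∂μ, b x ≤ 0) :
    μ.withDensity (fun x => ENNReal.ofReal (b x)) ≠ 0 := by
  contrapose! h
  filter_upwards [(withDensity_eq_zero_iff hb.ennreal_ofReal).1 h] with x hx
  exact ENNReal.ofReal_eq_zero.1 hx

end WithDensity

section Friedrichs

variable {Ω : Set Plane} {z₁ z₂ : ℝ} {b : Space → ℝ}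

theorem IsLipschitzDomain.cylinder_friedrichs (hΩ : IsLipschitzDomain Ω) (hz : z₁ < z₂)
    (hb : MemLp b ⊤ (boundaryMeasure Ω z₁ z₂))
    (hb_pos : ¬∀ᵐ y ∂boundaryMeasure Ω z₁ z₂, b y ≤ 0) :
    ∃ C : ℝ≥0∞, C ≠ ⊤ ∧ ∀ ψ : Space → ℝ, ContDiff ℝ 1 ψ →
      (∫⁻ y in cylinder Ω z₁ z₂, ‖ψ y‖ₑ ^ 2) + ∫⁻ y, ‖ψ y‖ₑ ^ 2 ∂boundaryMeasure Ω z₁ z₂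
        ≤ C * (cylinderEnergy Ω z₁ z₂ ψ + ∫⁻ y, ‖ψ y‖ₑ ^ 2
          ∂(boundaryMeasure Ω z₁ z₂).withDensity fun y => ENNReal.ofReal (b y)) := by
  have := hΩ.isFiniteMeasure_volume
  have := hΩ.isFiniteMeasure_frontier
  have : IsFiniteMeasure
      ((boundaryMeasure Ω z₁ z₂).withDensity fun y => ENNReal.ofReal (b y)) :=
    isFiniteMeasure_withDensity_ofReal (hb.integrable le_top).2
  have controlled_by_boundary := (hΩ.cylinder_poincare hz).mono (Measure.le_add_left le_rfl) le_rfl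
  have controlled_by_weight := (controlled_by_boundary.smul_left _).mono
    (withDensity_ofReal_le_smul hb) le_rfl |>.symm measurable_of_contDiff_one
  obtain ⟨C, hC, h⟩ := controlled_by_weight.friedrichs measurable_of_contDiff_one
    (withDensity_ofReal_ne_zero hb.1.aemeasurable hb_pos)
  exact ⟨C, hC, fun ψ hψ => lintegral_add_measure (fun y => ‖ψ y‖ₑ ^ 2) _ _ ▸ h ψ hψ⟩

theorem IsLipschitzDomain.friedrichs_traceData (hΩ : IsLipschitzDomain Ω) (hz : z₁ < z₂)
    (hb : MemLp b ⊤ (boundaryMeasure Ω z₁ z₂))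
    (hb_nonneg : ∀ᵐ y ∂boundaryMeasure Ω z₁ z₂, 0 ≤ b y)
    (hb_pos : ¬∀ᵐ y ∂boundaryMeasure Ω z₁ z₂, b y ≤ 0) :
    ∃ C : ℝ, 0 ≤ C ∧ ∀ X ∈ traceData Ω z₁ z₂, ‖valL X‖ ^ 2 + ‖traceL X‖ ^ 2
      ≤ C * (‖gradL X‖ ^ 2 + ‖dzL X‖ ^ 2 + weightedInner b hb (traceL X) (traceL X)) := by
  obtain ⟨C, hC, h⟩ := hΩ.cylinder_friedrichs hz hb hb_pos
  refine ⟨C.toReal, ENNReal.toReal_nonneg, fun X hX => ?_⟩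
  refine traceData_induction (p := fun X => ‖valL X‖ ^ 2 + ‖traceL X‖ ^ 2
    ≤ C.toReal * (‖gradL X‖ ^ 2 + ‖dzL X‖ ^ 2 + weightedInner b hb (traceL X) (traceL X))) ?_ ?_ hX
  · have := continuous_weightedInner hb (traceL (Ω := Ω) (z₁ := z₁) (z₂ := z₂)) traceL
    exact isClosed_le (by fun_prop) (by fun_prop)
  intro Y ψ hψ hY
  have weighted_nonneg : 0 ≤ weightedInner b hb (traceL Y) (traceL Y) :=
    weightedInner_self_nonneg hb (hb_nonneg.mono fun _ => .inr)
  rw [← ENNReal.ofReal_le_ofReal_iff (by positivity), ENNReal.ofReal_mul ENNReal.toReal_nonneg,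
    ENNReal.ofReal_add (by positivity) (by positivity),
    ENNReal.ofReal_add (by positivity) weighted_nonneg,
    ENNReal.ofReal_add (by positivity) (by positivity), ENNReal.ofReal_toReal hC,
    ofReal_norm_sq_eq_lintegral hY.val, ofReal_norm_sq_eq_lintegral hY.trace,
    ofReal_norm_sq_eq_lintegral hY.grad, ofReal_norm_sq_eq_lintegral hY.dz,
    ofReal_weightedInner_self hb hb_nonneg hY.trace]
  exact h ψ (contDiff_one_of_contDiff_infty hψ)

end Friedrichs

section ControlWeight

variable {Ω : Set Plane} {z₁ z₂ : ℝ} {Γ : LateralPartition Ω} {a : Plane → ℝ} {ΩD : Set Space}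

/-- The density, on the boundary of the cylinder, of the boundary terms that exclude nonzero
constants: `1` on the Dirichlet parts and the Robin coefficient on the Robin part. -/
noncomputable def controlWeight (Γ : LateralPartition Ω) (z₁ z₂ : ℝ) (ΩD : Set Space)
    (a : Plane → ℝ) : Space → ℝ :=
  (ΩD ∪ Γ.ΓD ×ˢ Ioo z₁ z₂).indicator (fun _ => 1)
    + (Γ.ΓR ×ˢ Ioo z₁ z₂).indicator (fun y => a y.1)

variable [SFinite ((Measure.hausdorffMeasure 1 : Measure Plane).restrict (frontier Ω))]

lemma ae_robin_nonneg (ha_pos : ∀ᵐ x ∂(Measure.hausdorffMeasure 1).restrict Γ.ΓR, 0 < a x) :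
    ∀ᵐ y ∂boundaryMeasure Ω z₁ z₂, 0 ≤ (Γ.ΓR ×ˢ Ioo z₁ z₂).indicator (fun y => a y.1) y := by
  filter_upwards [ae_lateral Γ.ΓR_subset Γ.measurableSet_ΓR ha_pos] with y hy
  exact indicator_apply_nonneg fun hyR => (hy hyR).le

lemma memLp_top_controlWeight (ha : MemLp a ⊤ ((Measure.hausdorffMeasure 1).restrict Γ.ΓR))
    (hΩD : MeasurableSet ΩD) :
    MemLp (controlWeight Γ z₁ z₂ ΩD a) ⊤ (boundaryMeasure Ω z₁ z₂) := by
  have measurableSet_dirichlet : MeasurableSet (ΩD ∪ Γ.ΓD ×ˢ Ioo z₁ z₂) :=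
    hΩD.union (Γ.measurableSet_ΓD.prod measurableSet_Ioo)
  exact MemLp.add (MemLp.indicator measurableSet_dirichlet (memLp_top_const (1 : ℝ)))
    (memLp_top_indicator_lateral Γ.ΓR_subset Γ.measurableSet_ΓR ha)

lemma ae_controlWeight_nonneg
    (ha_pos : ∀ᵐ x ∂(Measure.hausdorffMeasure 1).restrict Γ.ΓR, 0 < a x) :
    ∀ᵐ y ∂boundaryMeasure Ω z₁ z₂, 0 ≤ controlWeight Γ z₁ z₂ ΩD a y := by
  filter_upwards [ae_robin_nonneg ha_pos] with y hy
  exact add_nonneg (indicator_apply_nonneg fun _ => zero_le_one) hy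

lemma not_ae_controlWeight_nonpos
    (ha_pos : ∀ᵐ x ∂(Measure.hausdorffMeasure 1).restrict Γ.ΓR, 0 < a x)
    (hcontrol : boundaryMeasure Ω z₁ z₂ (ΩD ∪ (Γ.ΓD ∪ Γ.ΓR) ×ˢ Ioo z₁ z₂) ≠ 0) :
    ¬∀ᵐ y ∂boundaryMeasure Ω z₁ z₂, controlWeight Γ z₁ z₂ ΩD a y ≤ 0 := by
  contrapose! hcontrol
  rw [measure_eq_zero_iff_ae_notMem]
  filter_upwards [hcontrol, ae_robin_nonneg ha_pos,
    ae_lateral Γ.ΓR_subset Γ.measurableSet_ΓR ha_pos] with y nonpos robin_nonneg robin_pos hy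
  have weight_pos : 0 < controlWeight Γ z₁ z₂ ΩD a y := by
    rw [union_prod, ← union_assoc] at hy
    rcases hy with hyD | hyR
    · rw [controlWeight, Pi.add_apply, indicator_of_mem hyD]
      linarith
    · rw [controlWeight, Pi.add_apply, indicator_of_mem hyR fun y => a y.1]
      exact add_pos_of_nonneg_of_pos (indicator_apply_nonneg fun _ => zero_le_one) (robin_pos hyR)
  exact nonpos.not_gt weight_pos

lemma weightedInner_controlWeight (ha : MemLp a ⊤ ((Measure.hausdorffMeasure 1).restrict Γ.ΓR))
    (hΩD : MeasurableSet ΩD) {X : DataSpace Ω z₁ z₂} (hX : X ∈ testData z₁ z₂ Γ ΩD) :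
    weightedInner _ (memLp_top_controlWeight ha hΩD) (traceL X) (traceL X)
      = weightedInner _ (memLp_top_indicator_lateral Γ.ΓR_subset Γ.measurableSet_ΓR ha)
          (traceL X) (traceL X) := by
  rw [weightedInner_eq_integral _ .rfl .rfl, weightedInner_eq_integral _ .rfl .rfl]
  refine integral_congr_ae ?_
  filter_upwards [(ae_restrict_iff' hΩD).1 hX.2.2, (ae_restrict_iff'
    (Γ.measurableSet_ΓD.prod measurableSet_Ioo)).1 hX.2.1.1] with y zero_on_ΩD zero_on_ΓD
  by_cases hy : y ∈ ΩD ∪ Γ.ΓD ×ˢ Ioo z₁ z₂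
  · have vanishes : traceL X y = 0 := hy.elim zero_on_ΩD zero_on_ΓD
    rw [vanishes, inner_zero_left, mul_zero, mul_zero]
  · rw [controlWeight, Pi.add_apply, indicator_of_notMem hy, zero_add]

end ControlWeight

section LaxMilgram

variable {V : Type*} [NormedAddCommGroup V] [InnerProductSpace ℝ V] [CompleteSpace V]
  {K : Submodule ℝ V} {B : V →L[ℝ] V →L[ℝ] ℝ} {δ : ℝ}

lemma exists_mem_forall_eq_of_coercive (hK : IsClosed (K : Set V)) (hδ : 0 < δ)
    (hB : ∀ X ∈ K, δ * ‖X‖ ^ 2 ≤ B X X) (l : V →L[ℝ] ℝ) : ∃ X ∈ K, ∀ Y ∈ K, B X Y = l Y := by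
  have := hK.completeSpace_coe
  have coercive : IsCoercive (B.bilinearComp K.subtypeL K.subtypeL) :=
    ⟨δ, hδ, fun X => by simpa [sq, mul_assoc] using hB X X.2⟩
  let f : K := (InnerProductSpace.toDual ℝ K).symm (l.comp K.subtypeL)
  refine ⟨coercive.continuousLinearEquivOfBilin.symm f, Submodule.coe_mem _, fun Y hY => ?_⟩
  have bilin_eq_inner := coercive.continuousLinearEquivOfBilin_apply
    (coercive.continuousLinearEquivOfBilin.symm f) ⟨Y, hY⟩
  rw [ContinuousLinearEquiv.apply_symm_apply] at bilin_eq_inner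
  exact bilin_eq_inner.symm.trans InnerProductSpace.toDual_symm_apply

theorem existsUnique_sub_mem_forall_eq_of_coercive (hK : IsClosed (K : Set V)) (hδ : 0 < δ)
    (hB : ∀ X ∈ K, δ * ‖X‖ ^ 2 ≤ B X X) (l : V →L[ℝ] ℝ) (X₀ : V) :
    ∃! X, X - X₀ ∈ K ∧ ∀ Y ∈ K, B X Y = l Y := by
  obtain ⟨U, hU, hU_eq⟩ := exists_mem_forall_eq_of_coercive hK hδ hB (l - B X₀)
  have sol_eq (Y : V) (hY : Y ∈ K) : B (X₀ + U) Y = l Y := by simp [hU_eq Y hY]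
  refine ⟨X₀ + U, ⟨by simpa using hU, sol_eq⟩, ?_⟩
  rintro X ⟨hX, hX_eq⟩
  have diff_mem : X - (X₀ + U) ∈ K := by simpa [sub_sub] using sub_mem hX hU
  have form_diff (Y : V) (hY : Y ∈ K) : B (X - (X₀ + U)) Y = 0 := by
    rw [map_sub, sub_apply, hX_eq Y hY, sol_eq Y hY, sub_self]
  have norm_sq_nonpos : ‖X - (X₀ + U)‖ ^ 2 ≤ 0 :=
    nonpos_of_mul_nonpos_right ((hB _ diff_mem).trans_eq (form_diff _ diff_mem)) hδ
  simpa [sub_eq_zero] using norm_sq_nonpos.antisymm (sq_nonneg _)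

end LaxMilgram

section Form

variable {Ω : Set Plane} {z₁ z₂ : ℝ} {Γ : LateralPartition Ω} {c σ h a : Plane → ℝ}

lemma IsDiffusionCoefficient.memLp_top {f : Plane → ℝ} (hf : IsDiffusionCoefficient Ω f) :
    MemLp f ⊤ (volume.restrict Ω) := by
  obtain ⟨hf_meas, m, M, hm, hbound⟩ := hf
  refine memLp_top_of_bound hf_meas M ?_
  filter_upwards [hbound] with x hx
  rw [Real.norm_of_nonneg (hm.le.trans hx.1)]
  exact hx.2

lemma integral_indicator_mul_inner_indicator {ΩN : Set Space} {SN : Space → ℝ}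
    (hΩ : MeasurableSet Ω) (hΩN : MeasurableSet ΩN) (z : ℝ) (k : Space → ℝ) (μ : Measure Space) :
    ∫ y, (Ω ×ˢ {z}).indicator (fun y => c y.1) y * inner ℝ (ΩN.indicator SN y) (k y) ∂μ
      = ∫ y in ΩN ∩ Ω ×ˢ {z}, c y.1 * SN y * k y ∂μ := by
  rw [← integral_indicator (hΩN.inter (hΩ.prod (measurableSet_singleton z)))]
  refine integral_congr_ae (.of_forall fun y => ?_)
  by_cases hyN : y ∈ ΩN <;> by_cases hy : y ∈ Ω ×ˢ {z} <;>
    simp [indicator, hyN, hy, mul_comm, mul_left_comm]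

variable [SFinite ((Measure.hausdorffMeasure 1 : Measure Plane).restrict (frontier Ω))]

section FormL

variable (hc : MemLp c ⊤ (volume.restrict Ω)) (hσ : MemLp σ ⊤ (volume.restrict Ω))
  (hh : MemLp h ⊤ (volume.restrict Ω))
  (ha : MemLp a ⊤ ((Measure.hausdorffMeasure 1).restrict Γ.ΓR))

variable (z₁ z₂) in
/-- The variational form `form` as a bounded bilinear form on quadruples. -/
noncomputable def formL : DataSpace Ω z₁ z₂ →L[ℝ] DataSpace Ω z₁ z₂ →L[ℝ] ℝ :=
  (weightedInner _ (memLp_top_cylinder hc)).bilinearComp dzL dzL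
    + (weightedInner _ (memLp_top_cylinder hσ)).bilinearComp gradL gradL
    + (weightedInner _ (memLp_top_cylinder hh)).bilinearComp dzL valL
    + (weightedInner _ (memLp_top_indicator_lateral Γ.ΓR_subset Γ.measurableSet_ΓR
        ha)).bilinearComp traceL traceL

lemma formL_apply (X Y : DataSpace Ω z₁ z₂) : formL z₁ z₂ hc hσ hh ha X Y =
    weightedInner _ (memLp_top_cylinder hc) (dzL X) (dzL Y)
      + weightedInner _ (memLp_top_cylinder hσ) (gradL X) (gradL Y)
      + weightedInner _ (memLp_top_cylinder hh) (dzL X) (valL Y)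
      + weightedInner _ (memLp_top_indicator_lateral Γ.ΓR_subset Γ.measurableSet_ΓR ha)
          (traceL X) (traceL Y) := rfl

lemma form_eq_formL {T φ : H1 Ω z₁ z₂} {g k : Space → ℝ} {X Y : DataSpace Ω z₁ z₂}
    (hX : Represents X T.val T.grad T.dz g) (hY : Represents Y φ.val φ.grad φ.dz k) :
    form Γ c σ h a T g φ k = formL z₁ z₂ hc hσ hh ha X Y := by
  have int_c := integrable_weighted (memLp_top_cylinder hc) hX.dz hY.dz
  have int_σ := integrable_weighted (memLp_top_cylinder hσ) hX.grad hY.grad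
  have int_h := integrable_weighted (memLp_top_cylinder hh) hX.dz hY.val
  rw [formL_apply, form, weightedInner_eq_integral _ hX.dz hY.dz,
    weightedInner_eq_integral _ hX.grad hY.grad, weightedInner_eq_integral _ hX.dz hY.val,
    weightedInner_indicator_eq_setIntegral (Γ.measurableSet_ΓR.prod measurableSet_Ioo) _
      hX.trace hY.trace, ← integral_add int_c int_σ, ← integral_add (int_c.fun_add int_σ) int_h]
  congr 1
  refine integral_congr_ae (.of_forall fun y => ?_)
  simp only [RCLike.inner_apply, conj_trivial]
  ring

theorem exists_friedrichs_testData (hΩ : IsLipschitzDomain Ω) (hz : z₁ < z₂)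
    (ha_pos : ∀ᵐ x ∂(Measure.hausdorffMeasure 1).restrict Γ.ΓR, 0 < a x)
    {ΩD : Set Space} (hΩD : MeasurableSet ΩD)
    (hcontrol : boundaryMeasure Ω z₁ z₂ (ΩD ∪ (Γ.ΓD ∪ Γ.ΓR) ×ˢ Ioo z₁ z₂) ≠ 0) :
    ∃ C : ℝ, 0 ≤ C ∧ ∀ X ∈ testData z₁ z₂ Γ ΩD, ‖valL X‖ ^ 2 + ‖traceL X‖ ^ 2
      ≤ C * (‖gradL X‖ ^ 2 + ‖dzL X‖ ^ 2 + weightedInner _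
        (memLp_top_indicator_lateral Γ.ΓR_subset Γ.measurableSet_ΓR ha)
          (traceL X) (traceL X)) := by
  obtain ⟨C, hC, friedrichs⟩ := hΩ.friedrichs_traceData hz (memLp_top_controlWeight ha hΩD)
    (ae_controlWeight_nonneg ha_pos) (not_ae_controlWeight_nonpos ha_pos hcontrol)
  refine ⟨C, hC, fun X hX => ?_⟩
  rw [← weightedInner_controlWeight ha hΩD hX]
  exact friedrichs X hX.1

end FormL

theorem exists_coercive_formL (hΩ : IsLipschitzDomain Ω) (hz : z₁ < z₂)
    (hc : IsDiffusionCoefficient Ω c) (hσ : IsDiffusionCoefficient Ω σ)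
    (hh : MemLp h ⊤ (volume.restrict Ω))
    (ha : MemLp a ⊤ ((Measure.hausdorffMeasure 1).restrict Γ.ΓR))
    (ha_pos : ∀ᵐ x ∂(Measure.hausdorffMeasure 1).restrict Γ.ΓR, 0 < a x)
    {ΩD : Set Space} (hΩD : MeasurableSet ΩD)
    (hin₁ : ∀ᵐ x ∂volume.restrict Ω, 0 < h x → (x, z₁) ∈ ΩD)
    (hin₂ : ∀ᵐ x ∂volume.restrict Ω, h x < 0 → (x, z₂) ∈ ΩD)
    (hcontrol : boundaryMeasure Ω z₁ z₂ (ΩD ∪ (Γ.ΓD ∪ Γ.ΓR) ×ˢ Ioo z₁ z₂) ≠ 0) :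
    ∃ δ : ℝ, 0 < δ ∧ ∀ X ∈ testData z₁ z₂ Γ ΩD,
      δ * ‖X‖ ^ 2 ≤ formL z₁ z₂ hc.memLp_top hσ.memLp_top hh ha X X := by
  obtain ⟨C, hC, friedrichs⟩ := exists_friedrichs_testData ha hΩ hz ha_pos hΩD hcontrol
  obtain ⟨m₁, M₁, hm₁, hc_bound⟩ := hc.2
  obtain ⟨m₂, M₂, hm₂, hσ_bound⟩ := hσ.2
  refine ⟨min 1 (min m₁ m₂) / (1 + C), by positivity, fun X hX => ?_⟩
  set m := min 1 (min m₁ m₂)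
  have diffusion_axial := mul_norm_sq_le_weightedInner_self (memLp_top_cylinder hc.memLp_top)
    (m := m) (ae_cylinder (hc_bound.mono fun x hx =>
      ((min_le_right _ _).trans (min_le_left _ _)).trans hx.1)) (dzL X)
  have diffusion_cross := mul_norm_sq_le_weightedInner_self (memLp_top_cylinder hσ.memLp_top)
    (m := m) (ae_cylinder (hσ_bound.mono fun x hx =>
      ((min_le_right _ _).trans (min_le_right _ _)).trans hx.1)) (gradL X)
  have convection := convection_nonneg hΩ.isOpen hz hh hΩD hin₁ hin₂ hX
  rw [formL_apply, norm_sq_eq]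
  set r := weightedInner _ (memLp_top_indicator_lateral Γ.ΓR_subset Γ.measurableSet_ΓR ha)
    (traceL X) (traceL X)
  have robin : m * r ≤ r := mul_le_of_le_one_left
    (weightedInner_self_nonneg _ ((ae_robin_nonneg ha_pos).mono fun _ => .inr)) (min_le_left _ _)
  calc m / (1 + C) * (‖valL X‖ ^ 2 + ‖gradL X‖ ^ 2 + ‖dzL X‖ ^ 2 + ‖traceL X‖ ^ 2)
      ≤ m / (1 + C) * ((1 + C) * (‖gradL X‖ ^ 2 + ‖dzL X‖ ^ 2 + r)) := by
        gcongr
        have r_nonneg : 0 ≤ r :=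
          weightedInner_self_nonneg _ ((ae_robin_nonneg ha_pos).mono fun _ => .inr)
        linarith [friedrichs X hX]
    _ = m * ‖gradL X‖ ^ 2 + m * ‖dzL X‖ ^ 2 + m * r := by field_simp
    _ ≤ _ := by linarith

section NeumannLoad

variable {ΩN : Set Space} {SN : Space → ℝ}

variable (hΩ : IsOpen Ω) (hz : z₁ < z₂) (hc : MemLp c ⊤ (volume.restrict Ω))
  (hΩN : MeasurableSet ΩN) (hSN : MemLp SN 2 ((boundaryMeasure Ω z₁ z₂).restrict ΩN))

/-- The right-hand side of the weak formulation as a bounded linear functional on quadruples. -/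
noncomputable def neumannLoad : DataSpace Ω z₁ z₂ →L[ℝ] ℝ :=
  (weightedInner _ (memLp_top_axialFlux hΩ hz hc)
    (((memLp_indicator_iff_restrict hΩN).2 hSN).toLp (ΩN.indicator SN))).comp traceL

lemma neumannLoad_apply {Y : DataSpace Ω z₁ z₂} {k : Space → ℝ}
    (hk : traceL Y =ᵐ[boundaryMeasure Ω z₁ z₂] k) : neumannLoad hΩ hz hc hΩN hSN Y =
      (∫ y in ΩN ∩ Ω ×ˢ {z₂}, c y.1 * SN y * k y ∂boundaryMeasure Ω z₁ z₂)
        - ∫ y in ΩN ∩ Ω ×ˢ {z₁}, c y.1 * SN y * k y ∂boundaryMeasure Ω z₁ z₂ := by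
  have toLp_ae_eq := ((memLp_indicator_iff_restrict hΩN).2 hSN).coeFn_toLp
  rw [← integral_indicator_mul_inner_indicator hΩ.measurableSet hΩN,
    ← integral_indicator_mul_inner_indicator hΩ.measurableSet hΩN, ← integral_sub
      (integrable_weighted (memLp_top_indicator_section hΩ hz (.inr rfl) hc) toLp_ae_eq hk)
      (integrable_weighted (memLp_top_indicator_section hΩ hz (.inl rfl) hc) toLp_ae_eq hk)]
  refine (weightedInner_eq_integral (memLp_top_axialFlux hΩ hz hc) toLp_ae_eq hk).trans ?_
  simp only [axialFlux, Pi.sub_apply, sub_mul]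

end NeumannLoad

section WeakSolution

variable {ΩD ΩN : Set Space} {TD SN : Space → ℝ} {T : H1 Ω z₁ z₂}

lemma isWeakSolution_iff (hΩ : IsOpen Ω) (hz : z₁ < z₂) (hc : MemLp c ⊤ (volume.restrict Ω))
    (hσ : MemLp σ ⊤ (volume.restrict Ω)) (hh : MemLp h ⊤ (volume.restrict Ω))
    (ha : MemLp a ⊤ ((Measure.hausdorffMeasure 1).restrict Γ.ΓR)) (hΩN : MeasurableSet ΩN)
    (hSN : MemLp SN 2 ((boundaryMeasure Ω z₁ z₂).restrict ΩN)) :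
    IsWeakSolution Γ ΩD ΩN c σ h a TD SN T ↔ ∃ X ∈ traceData Ω z₁ z₂,
      Represents X T.val T.grad T.dz (traceL X) ∧ EssentialConditions Γ z₁ z₂ ΩD TD (traceL X) ∧
      ∀ Y ∈ testData z₁ z₂ Γ ΩD,
        formL z₁ z₂ hc hσ hh ha X Y = neumannLoad hΩ hz hc hΩN hSN Y := by
  constructor
  · rintro ⟨g, ⟨hT, hT_ess⟩, hT_eq⟩
    obtain ⟨X, hX, hXT⟩ := hT.exists_data
    refine ⟨X, hX, { hXT with trace := .rfl },
      EssentialConditions.congr hT_ess hXT.trace.symm, fun Y hY => ?_⟩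
    rw [neumannLoad_apply hΩ hz hc hΩN hSN .rfl,
      ← hT_eq (H1.ofData hY.1) (traceL Y) ⟨hasTrace_ofData hY.1, hY.2⟩]
    exact (form_eq_formL hc hσ hh ha hXT (represents_self Y)).symm
  · rintro ⟨X, hX, hXT, hX_ess, hX_eq⟩
    refine ⟨traceL X, ⟨hasTrace_of_mem_traceData hXT hX, hX_ess⟩, fun φ k hφ => ?_⟩
    obtain ⟨Y, hY, hYφ⟩ := hφ.1.exists_data
    rw [form_eq_formL hc hσ hh ha hXT hYφ,
      hX_eq Y ⟨hY, EssentialConditions.congr hφ.2 hYφ.trace.symm⟩,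
      neumannLoad_apply hΩ hz hc hΩN hSN hYφ.trace]

lemma IsDirichletDatum.exists_data (h : IsDirichletDatum Γ z₁ z₂ ΩD TD) :
    ∃ X ∈ traceData Ω z₁ z₂, EssentialConditions Γ z₁ z₂ ΩD TD (traceL X) := by
  obtain ⟨G, g, hG, hG_ess⟩ := h
  obtain ⟨X, hX, hXG⟩ := hG.exists_data
  exact ⟨X, hX, EssentialConditions.congr hG_ess hXG.trace.symm⟩

end WeakSolution

end Form

end Graetz

open Graetz in
theorem mainTheorem9_general
    (Ω : Set Plane) (hΩ : IsLipschitzDomain Ω)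
    (z₁ z₂ : ℝ) (hz : z₁ < z₂)
    (c σ h a : Plane → ℝ)
    (hc : IsDiffusionCoefficient Ω c) (hσ : IsDiffusionCoefficient Ω σ)
    (hh : MemLp h ∞ (volume.restrict Ω))
    (Γ : LateralPartition Ω)
    (ha : MemLp a ∞ ((Measure.hausdorffMeasure 1).restrict Γ.ΓR))
    (ha_pos : ∀ᵐ x ∂(Measure.hausdorffMeasure 1).restrict Γ.ΓR, 0 < a x)
    (ΩD ΩN : Set Space) (hΩD : MeasurableSet ΩD) (hΩN : MeasurableSet ΩN)
    (hin₁ : ∀ᵐ x ∂volume.restrict Ω, 0 < h x → (x, z₁) ∈ ΩD)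
    (hin₂ : ∀ᵐ x ∂volume.restrict Ω, h x < 0 → (x, z₂) ∈ ΩD)
    (hcontrol : boundaryMeasure Ω z₁ z₂ (ΩD ∪ (Γ.ΓD ∪ Γ.ΓR) ×ˢ Ioo z₁ z₂) ≠ 0)
    (TD SN : Space → ℝ)
    (hTD : IsDirichletDatum Γ z₁ z₂ ΩD TD)
    (hSN : MemLp SN 2 ((boundaryMeasure Ω z₁ z₂).restrict ΩN)) :
    ∃ T : H1 Ω z₁ z₂, IsWeakSolution Γ ΩD ΩN c σ h a TD SN T ∧
      ∀ T' : H1 Ω z₁ z₂, IsWeakSolution Γ ΩD ΩN c σ h a TD SN T' →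
        T'.val =ᵐ[volume.restrict (cylinder Ω z₁ z₂)] T.val := by
  have := hΩ.isFiniteMeasure_frontier
  have weakSolution_iff (T : H1 Ω z₁ z₂) := isWeakSolution_iff (T := T) (TD := TD) (ΩD := ΩD)
    hΩ.isOpen hz hc.memLp_top hσ.memLp_top hh ha hΩN hSN
  obtain ⟨X₀, hX₀, hX₀_ess⟩ := hTD.exists_data
  obtain ⟨δ, hδ, coercive⟩ := exists_coercive_formL hΩ hz hc hσ hh ha ha_pos hΩD hin₁ hin₂
    hcontrol
  obtain ⟨X, ⟨hX, hX_eq⟩, hX_unique⟩ := existsUnique_sub_mem_forall_eq_of_coercive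
    isClosed_testData hδ coercive (neumannLoad hΩ.isOpen hz hc.memLp_top hΩN hSN) X₀
  rw [sub_mem_testData_iff hX₀ hX₀_ess] at hX
  refine ⟨H1.ofData hX.1,
    (weakSolution_iff _).2 ⟨X, hX.1, DataSpace.represents_self X, hX.2, hX_eq⟩, fun T' hT' => ?_⟩
  obtain ⟨X', hX', hX'T', hX'_ess, hX'_eq⟩ := (weakSolution_iff T').1 hT'
  obtain rfl := hX_unique X' ⟨(sub_mem_testData_iff hX₀ hX₀_ess).2 ⟨hX', hX'_ess⟩, hX'_eq⟩
  exact hX'T'.val.symm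

theorem mainTheorem9
    (Ω : Set Graetz.Plane) (hΩ : Graetz.IsLipschitzDomain Ω)
    (z₁ z₂ : ℝ) (hz : z₁ < z₂)
    (c σ h a : Graetz.Plane → ℝ)
    (hc : Graetz.IsDiffusionCoefficient Ω c) (hσ : Graetz.IsDiffusionCoefficient Ω σ)
    (hh : MemLp h ∞ (volume.restrict Ω))
    (Γ : Graetz.LateralPartition Ω)
    (ha : MemLp a ∞ ((Measure.hausdorffMeasure 1).restrict Γ.ΓR))
    (ha_pos : ∀ᵐ x ∂(Measure.hausdorffMeasure 1).restrict Γ.ΓR, 0 < a x)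
    (ΩD ΩN : Set Graetz.Space) (hΩD : MeasurableSet ΩD) (hΩN : MeasurableSet ΩN)
    (hdisj : Disjoint ΩD ΩN) (hunion : ΩD ∪ ΩN = Ω ×ˢ {z₁, z₂})
    -- the flow enters only through the Dirichlet part of the inlet/outlet
    (hin₁ : ∀ᵐ x ∂volume.restrict Ω, 0 < h x → (x, z₁) ∈ ΩD)
    (hin₂ : ∀ᵐ x ∂volume.restrict Ω, h x < 0 → (x, z₂) ∈ ΩD)
    -- not a pure Neumann/periodic problem, whose solutions are determined up to constants only
    (hcontrol : Graetz.boundaryMeasure Ω z₁ z₂ (ΩD ∪ (Γ.ΓD ∪ Γ.ΓR) ×ˢ Ioo z₁ z₂) ≠ 0)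
    (TD SN : Graetz.Space → ℝ)
    (hTD : Graetz.IsDirichletDatum Γ z₁ z₂ ΩD TD)
    (hSN : MemLp SN 2 ((Graetz.boundaryMeasure Ω z₁ z₂).restrict ΩN)) :
    ∃ T : Graetz.H1 Ω z₁ z₂, Graetz.IsWeakSolution Γ ΩD ΩN c σ h a TD SN T ∧
      ∀ T' : Graetz.H1 Ω z₁ z₂, Graetz.IsWeakSolution Γ ΩD ΩN c σ h a TD SN T' →
        T'.val =ᵐ[volume.restrict (Graetz.cylinder Ω z₁ z₂)] T.val :=
  mainTheorem9_general Ω hΩ z₁ z₂ hz c σ h a hc hσ hh Γ ha ha_pos ΩD ΩN hΩD hΩN hin₁ hin₂ hcontrol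
    TD SN hTD hSN
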